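/- Write $z=(t,x,v)\in\mathbb R\times\mathbb R^d\times\mathbb R^d$, $d\ge 1$, and set $z\circ z'=(t+t',\,x+x'+t'v,\,v+v')$, $z^{-1}=(-t,\,-x+tv,\,-v)$, $\delta_r z=(r^2t,\,r^3x,\,rv)$ and $Y=\partial_t+v\cdot\nabla_x$; for sets, $A\circ B=\{a\circ b: a\in A,\ b\in B\}$, $A^{-1}=\{a^{-1}:a\in A\}$ and $\delta_rA=\{\delta_ra:a\in A\}$. For a measurable set $\Omega$ with interior $\Omega^\circ$ and $g\in L^2(\Omega)$ define $$\llbracket g\rrbracket_{H^1_{\rm kin}(\Omega)}=\|\nabla_v g\|_{L^2(\Omega^\circ)}+\sup\Big\{-\int_{\Omega^\circ} g\,Yh\,dz \;:\; h\in C_c^\infty(\Omega^\circ),\ \|\nabla_v h\|_{L^2}=1\Big\},$$ where $\nabla_v g$ is the weak gradient in $\Omega^\circ$ (the first term is $+\infty$ if there is none in $L^2$), and let $H^1_{\rm kin}(\Omega)$ be the set of real-valued $g\in L^2(\Omega)$ for which this is finite. The supremum is the dual norm of the distribution $Yg$. **Theorem.** For every $d\ge1$ and every nonempty bounded open set $B\subset\mathbb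 R\times\mathbb R^{2d}$ there is a constant $C$, depending only on $B$ and $d$, with the following property. Let $s_0>0$ and let $\Omega_1,\Omega_2\subset[0,\infty)\times\mathbb R^{2d}$ be measurable sets such that $$\Omega_1\circ(\delta_sB)^{-1}\subset\Omega_2\qquad\text{for all } s\in[0,s_0].$$ Then, for all $g\in H^1_{\rm kin}(\Omega_2)$ and all $s\in(0,s_0]$, $$\|g\|_{L^2(\Omega_1)}^2\le C\Big(s\,\llbracket g\rrbracket_{H^1_{\rm kin}(\Omega_2)}\,\|g\|_{L^2(\Omega_2)}+\frac1{s^{4d+2}}\|g\|_{L^1(\Omega_2)}^2\Big),$$ where the right-hand side may be infinite if $g\notin L^1(\Omega_2)$. -/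

import Mathlib

open MeasureTheory Set
open scoped ENNReal NNReal ContDiff

noncomputable section

namespace KineticNash

/-- The Euclidean space in which positions `x` and velocities `v` live. -/
abbrev Vec (d : ℕ) := EuclideanSpace ℝ (Fin d)

/-- Points `z = (t, x, v)` of `ℝ × ℝ^d × ℝ^d`, with Lebesgue measure as `volume`. -/
abbrev Phase (d : ℕ) := ℝ × Vec d × Vec d

variable {d : ℕ}

/-- The Galilean group law `(t, x, v) ∘ (t', x', v') = (t + t', x + x' + t' v, v + v')`. -/
def kinMul (z z' : Phase d) : Phase d :=
  (z.1 + z'.1, z.2.1 + z'.2.1 + z'.1 • z.2.2, z.2.2 + z'.2.2)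

/-- The group inverse `(t, x, v)⁻¹ = (-t, -x + t v, -v)`. -/
def kinInv (z : Phase d) : Phase d :=
  (-z.1, -z.2.1 + z.1 • z.2.2, -z.2.2)

/-- The kinetic dilation `δ_r (t, x, v) = (r² t, r³ x, r v)`. -/
def kinDil (r : ℝ) (z : Phase d) : Phase d :=
  (r ^ 2 * z.1, r ^ 3 • z.2.1, r • z.2.2)

/-- `A ∘ B = {a ∘ b : a ∈ A, b ∈ B}`. -/
def setMul (A B : Set (Phase d)) : Set (Phase d) := Set.image2 kinMul A B

/-- `A⁻¹ = {a⁻¹ : a ∈ A}`. -/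
def setInv (A : Set (Phase d)) : Set (Phase d) := kinInv '' A

/-- `δ_r A = {δ_r a : a ∈ A}`. -/
def setDil (r : ℝ) (A : Set (Phase d)) : Set (Phase d) := kinDil r '' A

/-- The classical velocity gradient `∇_v h`. -/
def gradV (h : Phase d → ℝ) (z : Phase d) : Vec d :=
  WithLp.toLp 2 fun i => fderiv ℝ h z (0, 0, EuclideanSpace.single i 1)

/-- The classical transport derivative `Y h = ∂_t h + v · ∇_x h`. -/
def transport (h : Phase d → ℝ) (z : Phase d) : ℝ :=
  fderiv ℝ h z (1, z.2.2, 0)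

/-- Test functions: `C^∞` functions with compact support in the interior of `Ω`. -/
structure IsTest (Ω : Set (Phase d)) (h : Phase d → ℝ) : Prop where
  smooth : ContDiff ℝ ∞ h
  compact : HasCompactSupport h
  supp : tsupport h ⊆ interior Ω

/-- `G` is an `L²` weak velocity gradient of `g` in the interior of `Ω`. -/
structure IsWeakGradV (Ω : Set (Phase d)) (g : Phase d → ℝ) (G : Phase d → Vec d) : Prop where
  memLp : MemLp G 2 (volume.restrict (interior Ω))
  integral_eq : ∀ h, IsTest Ω h → ∀ i,
    ∫ z in interior Ω, g z * gradV h z i = -∫ z in interior Ω, G z i * h z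

/-- `‖∇_v g‖_{L²(Ω)}` for the weak gradient (which is unique almost everywhere); it is `∞` if `g`
has no weak velocity gradient in `L²`. -/
def gradVNorm (Ω : Set (Phase d)) (g : Phase d → ℝ) : ℝ≥0∞ :=
  ⨅ (G : Phase d → Vec d) (_ : IsWeakGradV Ω g G), eLpNorm G 2 (volume.restrict (interior Ω))

/-- The distributional pairing `⟨Y g, h⟩ = -∫ g (Y h)`; the field `∂_t + v · ∇_x` is divergence
free, so this is `∫ (Y g) h` when `g` is smooth. -/
def transportPairing (Ω : Set (Phase d)) (g h : Phase d → ℝ) : ℝ :=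
  -∫ z in interior Ω, g z * transport h z

/-- The dual (`L²_{t,x} H⁻¹_v`) seminorm of `Y g` on `Ω`: the supremum of `⟨Y g, h⟩` over the
test functions `h` with `‖∇_v h‖_{L²} = 1`. As `-h` is a test function whenever `h` is one,
truncating the pairing at `0` does not change the supremum. -/
def transportDualNorm (Ω : Set (Phase d)) (g : Phase d → ℝ) : ℝ≥0∞ :=
  ⨆ (h : Phase d → ℝ) (_ : IsTest Ω h)
    (_ : eLpNorm (gradV h) 2 (volume.restrict (interior Ω)) = 1),
    ENNReal.ofReal (transportPairing Ω g h)

/-- The seminorm `⟦g⟧_{H¹_kin(Ω)}`. -/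
def kinSeminorm (Ω : Set (Phase d)) (g : Phase d → ℝ) : ℝ≥0∞ :=
  gradVNorm Ω g + transportDualNorm Ω g

/-- The kinetic Sobolev space `H¹_kin(Ω)`. -/
structure MemKinH1 (Ω : Set (Phase d)) (g : Phase d → ℝ) : Prop where
  memLp : MemLp g 2 (volume.restrict Ω)
  seminorm_lt_top : kinSeminorm Ω g < ⊤

end KineticNash

end

open KineticNash

/-! ### The Galilean group: invariance of Lebesgue measure and dilations. -/

namespace KineticNash

open Filter Topology

/-! Fix a smooth bump `φ` with compact support in `B` and integral one, let `kern φ r` be its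
`L¹`-normalised dilates, and test `g` against the mollification of `f = 1_S g` on the group: `F(r) =
∫ g(w) (∫ f(z) kern φ r (w⁻¹ ∘ z) dz) dw`, with `S` a bounded piece of `Ω₁`. As `r → 0` this tends
to `‖g‖²_{L²(S)}` (`tendsto_pairing`), while at `r = s` the sup bound on the kernel, of order
`s^{-(4d+2)}`, gives the `L¹` term. It remains to show that `|F'|` is bounded by a constant times
`⟦g⟧ ‖f‖_{L²}` uniformly in `r`, which after integration over `(0, s]` yields the factor `s`.

The derivative of the kernel is `-r⁻¹ kern (dilGen φ) r`, where `dilGen φ` is the Euclidean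
divergence of `φ` times the dilation field. Since `∂_t` and `V_i = ∂_{v_i} + t ∂_{x_i}` satisfy
`[∂_t, V_i] = ∂_{x_i}`, the `x`-derivatives can be absorbed, and `dilGen φ = ∂_t (compT φ) + ∑ V_i
(compV φ i)` (`dilGen_eq`). Under the convolution these right-invariant fields become, up to sign,
the left-invariant fields `Y` and `∂_{v_i}` acting on the convolution (`transport_kconv`,
`gradV_kconv`), so `F'` is `g` tested against `Y h₀` and `∂_{v_i} h_i`. The scaling matches: the `Y`
term carries a factor `r` that cancels the `r⁻¹` in `‖∇_v h₀‖`, and the `v` terms carry no power of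
`r` (`enorm_deriv_pairing_le`). The hypothesis on `Ω₁ ∘ (δ_r B)⁻¹` places the supports of all these
test functions in the interior of `Ω₂`.

The resulting constant depends only on `φ`, so `S` can be let grow to `Ω₁`. -/

instance instIsAddHaarMeasureVolumePhase (d : ℕ) :
    (volume : Measure (Phase d)).IsAddHaarMeasure := by
  have : (volume : Measure (Vec d × Vec d)).IsAddHaarMeasure :=
    Measure.prod.instIsAddHaarMeasure (volume : Measure (Vec d)) (volume : Measure (Vec d))
  exact Measure.prod.instIsAddHaarMeasure (volume : Measure ℝ) (volume : Measure (Vec d × Vec d))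

/-- The left quotient `w⁻¹ ∘ z`. -/
def kinDiff {d : ℕ} (w z : Phase d) : Phase d := kinMul (kinInv w) z

variable {d : ℕ}

lemma kinDiff_eq (w z : Phase d) : kinDiff w z =
    (z.1 - w.1, z.2.1 - w.2.1 - (z.1 - w.1) • w.2.2, z.2.2 - w.2.2) := by
  simp only [kinDiff, kinMul, kinInv, Prod.mk.injEq]
  refine ⟨by ring, by module, by module⟩

lemma kinMul_kinDiff (w z : Phase d) : kinMul w (kinDiff w z) = z := by
  rw [kinDiff_eq]
  ext1
  · simp [kinMul]
  ext1
  · simp only [kinMul]; module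
  · simp [kinMul]

lemma kinDiff_kinMul (w y : Phase d) : kinDiff w (kinMul w y) = y := by
  rw [kinDiff_eq]
  ext1
  · simp [kinMul]
  ext1
  · simp only [kinMul]; module
  · simp [kinMul]

lemma kinMul_kinInv_kinDiff (w z : Phase d) : kinMul z (kinInv (kinDiff w z)) = w := by
  rw [kinDiff_eq]
  ext1
  · simp [kinMul, kinInv]
  ext1
  · simp only [kinMul, kinInv]; module
  · simp [kinMul, kinInv]

lemma contDiff_kinDiff : ContDiff ℝ ∞ fun p : Phase d × Phase d => kinDiff p.1 p.2 := by
  simp only [kinDiff_eq]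
  fun_prop

lemma continuous_kinDiff : Continuous fun p : Phase d × Phase d => kinDiff p.1 p.2 :=
  contDiff_kinDiff.continuous

lemma continuous_kinMul : Continuous fun p : Phase d × Phase d => kinMul p.1 p.2 := by
  unfold kinMul
  fun_prop

lemma continuous_kinInv : Continuous (kinInv : Phase d → Phase d) := by
  unfold kinInv
  fun_prop

lemma measurePreserving_kinDiff_right (w : Phase d) :
    MeasurePreserving (kinDiff w) volume volume := by
  have h1 : MeasurePreserving (fun t : ℝ => t - w.1) volume volume :=
    measurePreserving_sub_right volume w.1
  have h2 := h1.skew_product (μc := (volume : Measure (Vec d × Vec d)))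
    (μd := (volume : Measure (Vec d × Vec d)))
    (g := fun t p => (p.1 - w.2.1 - (t - w.1) • w.2.2, p.2 - w.2.2))
    (by apply Continuous.measurable; unfold Function.uncurry; fun_prop)
    (ae_of_all _ fun t => by
      have h3 : MeasurePreserving
        (fun x : Vec d => x - w.2.1 - (t - w.1) • w.2.2) volume volume := by
        simp only [sub_sub]
        exact measurePreserving_sub_right volume _
      exact (h3.prod (measurePreserving_sub_right volume w.2.2)).map_eq)
  have h3 : kinDiff w =
      fun z => (z.1 - w.1, z.2.1 - w.2.1 - (z.1 - w.1) • w.2.2, z.2.2 - w.2.2) := by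
    ext1 z
    rw [kinDiff_eq]
  rw [h3]
  exact h2

/-- Together with `measurePreserving_kinDiff_right` this expresses unimodularity, which makes both
marginals in Young's inequality equal. The map is triangular: reflect `t`, then `v` for fixed `t`,
then `x` for fixed `(t, v)`. -/
lemma measurePreserving_kinDiff_left (z : Phase d) :
    MeasurePreserving (fun w => kinDiff w z) volume volume := by
  have h1 : MeasurePreserving (fun t : ℝ => z.1 - t) volume volume :=
    Measure.measurePreserving_sub_left volume z.1
  have h2 := h1.skew_product (μc := (volume : Measure (Vec d × Vec d)))
    (μd := (volume : Measure (Vec d × Vec d)))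
    (g := fun t p => (z.2.1 - p.1 - (z.1 - t) • p.2, z.2.2 - p.2))
    (by apply Continuous.measurable; unfold Function.uncurry; fun_prop)
    (ae_of_all _ fun t => by
      have h3 := (Measure.measurePreserving_sub_left (volume : Measure (Vec d)) z.2.2).skew_product
        (μc := (volume : Measure (Vec d))) (μd := (volume : Measure (Vec d)))
        (g := fun v x => z.2.1 - x - (z.1 - t) • v)
        (by apply Continuous.measurable; unfold Function.uncurry; fun_prop)
        (ae_of_all _ fun v => by
          have : (fun x : Vec d => z.2.1 - x - (z.1 - t) • v)
              = fun x => (z.2.1 - (z.1 - t) • v) - x := by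
            ext1 x; module
          rw [this]
          exact (Measure.measurePreserving_sub_left volume _).map_eq)
      exact ((Measure.measurePreserving_swap.comp h3).comp
        Measure.measurePreserving_swap).map_eq)
  simp only [kinDiff_eq]
  exact h2

/-- The kinetic dilation as a continuous linear map. -/
def dilCLM (d : ℕ) (r : ℝ) : Phase d →L[ℝ] Phase d :=
  (r ^ 2 • ContinuousLinearMap.id ℝ ℝ).prodMap
    ((r ^ 3 • ContinuousLinearMap.id ℝ (Vec d)).prodMap (r • ContinuousLinearMap.id ℝ (Vec d)))

/-- The homogeneous dimension is `2 + 3d + d`. -/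
lemma det_dilCLM (r : ℝ) : LinearMap.det (dilCLM d r : Phase d →ₗ[ℝ] Phase d) = r ^ (4 * d + 2) := by
  have : (dilCLM d r : Phase d →ₗ[ℝ] Phase d) = (r ^ 2 • LinearMap.id).prodMap
    ((r ^ 3 • LinearMap.id).prodMap (r • LinearMap.id)) := by
    ext <;> simp [dilCLM]
  rw [this, LinearMap.det_prodMap, LinearMap.det_prodMap]
  simp only [LinearMap.det_smul, LinearMap.det_id, finrank_euclideanSpace, Fintype.card_fin,
    Module.finrank_self]
  ring

lemma kinDil_kinDil (r s : ℝ) (z : Phase d) : kinDil r (kinDil s z) = kinDil (r * s) z := by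
  simp [kinDil, smul_smul, mul_pow, mul_assoc]

lemma kinDil_one (z : Phase d) : kinDil 1 z = z := by simp [kinDil]

lemma kinDil_inv_cancel {r : ℝ} (hr : r ≠ 0) (z : Phase d) : kinDil r (kinDil r⁻¹ z) = z := by
  rw [kinDil_kinDil, mul_inv_cancel₀ hr, kinDil_one]

lemma kinDil_cancel_inv {r : ℝ} (hr : r ≠ 0) (z : Phase d) : kinDil r⁻¹ (kinDil r z) = z := by
  rw [kinDil_kinDil, inv_mul_cancel₀ hr, kinDil_one]

lemma continuous_kinDil : Continuous fun p : ℝ × Phase d => kinDil p.1 p.2 := by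
  unfold kinDil
  fun_prop

end KineticNash

/-! ### Group convolution: supports, smoothness, linearity. -/

namespace KineticNash

open Filter Topology

variable {d : ℕ}

/-- The convolution `f * ǩ` of the Galilean group: `w ↦ ∫ f(z) k(w⁻¹ ∘ z) dz`. -/
noncomputable def kconv (f k : Phase d → ℝ) (w : Phase d) : ℝ := ∫ z, f z * k (kinDiff w z)

lemma kinDiff_kinMul_kinInv (z y : Phase d) : kinDiff (kinMul z (kinInv y)) z = y := by
  rw [kinDiff_eq]
  ext1
  · simp [kinMul, kinInv]
  ext1
  · simp only [kinMul, kinInv]; module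
  · simp [kinMul, kinInv]

lemma mem_setMul_setInv {S U : Set (Phase d)} {w : Phase d} :
    w ∈ setMul S (setInv U) ↔ ∃ z ∈ S, kinDiff w z ∈ U := by
  constructor
  · rintro ⟨z, hz, _, ⟨y, hy, rfl⟩, rfl⟩
    exact ⟨z, hz, by rwa [kinDiff_kinMul_kinInv]⟩
  · rintro ⟨z, hz, hy⟩
    exact ⟨z, hz, _, ⟨_, hy, rfl⟩, kinMul_kinInv_kinDiff w z⟩

lemma isOpen_setMul_setInv {S U : Set (Phase d)} (hU : IsOpen U) :
    IsOpen (setMul S (setInv U)) := by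
  have : setMul S (setInv U) = ⋃ z ∈ S, (fun w => kinDiff w z) ⁻¹' U := by
    ext w
    simp [mem_setMul_setInv]
  rw [this]
  exact isOpen_biUnion fun z _ => hU.preimage (by
    exact continuous_kinDiff.comp (continuous_id.prodMk continuous_const))

lemma isCompact_setMul_setInv {S U : Set (Phase d)} (hS : IsCompact S) (hU : IsCompact U) :
    IsCompact (setMul S (setInv U)) := by
  have := (hS.prod (hU.image continuous_kinInv)).image continuous_kinMul
  rwa [Set.image_prod] at this

lemma tsupport_kconv_subset {f k : Phase d → ℝ} (hf : HasCompactSupport f)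
    (hk : HasCompactSupport k) :
    tsupport (kconv f k) ⊆ setMul (tsupport f) (setInv (tsupport k)) := by
  refine closure_minimal (fun w hw => ?_) (isCompact_setMul_setInv hf hk).isClosed
  by_contra h
  refine hw (integral_eq_zero_of_ae (ae_of_all _ fun z => ?_))
  by_contra hz
  obtain ⟨h1, h2⟩ := mul_ne_zero_iff.1 hz
  exact h (mem_setMul_setInv.2 ⟨z, subset_tsupport _ h1, subset_tsupport _ h2⟩)

lemma hasCompactSupport_kconv {f k : Phase d → ℝ} (hf : HasCompactSupport f)
    (hk : HasCompactSupport k) : HasCompactSupport (kconv f k) :=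
  (isCompact_setMul_setInv hf hk).of_isClosed_subset (isClosed_tsupport _)
    (tsupport_kconv_subset hf hk)

/-- Openness of `U` absorbs the closure of `S`: a limit point `z` of `S` with `w⁻¹ ∘ z ∈ U` can be
moved into `S`. Hence `f` may be cut off sharply to `S` although its support then only lies in
`closure S`. -/
lemma setMul_closure_subset {S K U : Set (Phase d)} (hU : IsOpen U) (hK : K ⊆ U) :
    setMul (closure S) (setInv K) ⊆ setMul S (setInv U) := by
  intro w hw
  obtain ⟨z, hz, hy⟩ := mem_setMul_setInv.1 hw
  have ho : IsOpen (kinDiff w ⁻¹' U) := hU.preimage (by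
    exact continuous_kinDiff.comp (continuous_const.prodMk continuous_id))
  obtain ⟨z', hz', hS⟩ := mem_closure_iff.1 hz _ ho (hK hy)
  exact mem_setMul_setInv.2 ⟨z', hS, hz'⟩

lemma tsupport_kconv_subset_interior {f k : Phase d → ℝ} {S U Ω : Set (Phase d)}
    (hf : HasCompactSupport f) (hk : HasCompactSupport k) (hfS : Function.support f ⊆ S)
    (hU : IsOpen U) (hkU : tsupport k ⊆ U) (h : setMul S (setInv U) ⊆ Ω) :
    tsupport (kconv f k) ⊆ interior Ω := by
  refine (tsupport_kconv_subset hf hk).trans ?_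
  refine Subset.trans ?_ (interior_maximal h (isOpen_setMul_setInv hU))
  refine Subset.trans ?_ (setMul_closure_subset hU hkU)
  exact image2_subset_right (closure_mono hfS)

/-- For fixed `w` the integral is a Euclidean convolution, evaluated at `0`, of `f` with the kernel
`x ↦ k (w⁻¹ ∘ (-x))`; smoothness in `w` is then smooth dependence of a convolution on a parameter.
-/
lemma contDiff_kconv {f k : Phase d → ℝ} (hf : LocallyIntegrable f)
    (hk : HasCompactSupport k) (hk' : ContDiff ℝ ∞ k) : ContDiff ℝ ∞ (kconv f k) := by
  rw [contDiff_iff_contDiffAt]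
  intro w₀
  let s := Metric.ball w₀ 1
  let K : Set (Phase d) :=
    (fun p : Phase d × Phase d => - kinMul p.1 p.2) '' (Metric.closedBall w₀ 1 ×ˢ tsupport k)
  have hK : IsCompact K :=
    ((isCompact_closedBall w₀ 1).prod hk).image continuous_kinMul.neg
  have hc := contDiffOn_convolution_right_with_param (μ := (volume : Measure (Phase d))) (n := ⊤)
    (ContinuousLinearMap.mul ℝ ℝ) (f := f) (g := fun p x => k (kinDiff p (-x)))
    (s := s) (k := K) Metric.isOpen_ball hK (fun p x hp hx => by
      by_contra h
      refine hx ⟨(p, kinDiff p (-x)), ⟨Metric.ball_subset_closedBall hp, subset_tsupport _ h⟩, ?_⟩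
      simp [kinMul_kinDiff]) hf
    (by
      apply ContDiff.contDiffOn
      exact hk'.comp (contDiff_kinDiff.comp (contDiff_fst.prodMk contDiff_snd.neg)))
  have h2 : ContDiffOn ℝ ∞ (kconv f k) s := by
    have := hc.comp (s := s) (contDiff_id.prodMk contDiff_const : ContDiff ℝ ∞ fun w : Phase d =>
      (w, (0 : Phase d))).contDiffOn (fun w hw => ⟨hw, mem_univ _⟩)
    refine this.congr fun w _ => ?_
    simp [kconv, convolution]
  exact h2.contDiffAt (Metric.isOpen_ball.mem_nhds (Metric.mem_ball_self one_pos))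

lemma isTest_kconv {f k : Phase d → ℝ} {S U Ω : Set (Phase d)} (hi : LocallyIntegrable f)
    (hf : HasCompactSupport f) (hk : HasCompactSupport k) (hk' : ContDiff ℝ ∞ k)
    (hfS : Function.support f ⊆ S)
    (hU : IsOpen U) (hkU : tsupport k ⊆ U) (h : setMul S (setInv U) ⊆ Ω) :
    IsTest Ω (kconv f k) :=
  ⟨contDiff_kconv hi hk hk', hasCompactSupport_kconv hf hk,
    tsupport_kconv_subset_interior hf hk hfS hU hkU h⟩

lemma continuous_comp_kinDiff_right {k : Phase d → ℝ} (hk : Continuous k) (w : Phase d) :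
    Continuous fun z => k (kinDiff w z) :=
  hk.comp (continuous_kinDiff.comp (continuous_const.prodMk continuous_id))

lemma integrable_mul_comp_kinDiff {f k : Phase d → ℝ} (hf : Integrable f)
    (hk : HasCompactSupport k) (hk' : Continuous k) (w : Phase d) :
    Integrable fun z => f z * k (kinDiff w z) := by
  obtain ⟨C, hC⟩ := hk.exists_bound_of_continuous hk'
  exact hf.mul_bdd (continuous_comp_kinDiff_right hk' w).aestronglyMeasurable
    (ae_of_all _ fun z => hC _)

lemma kconv_add_right {f k l : Phase d → ℝ} (hf : Integrable f)
    (hk : HasCompactSupport k) (hk' : Continuous k) (hl : HasCompactSupport l)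
    (hl' : Continuous l) (w : Phase d) :
    kconv f (fun y => k y + l y) w = kconv f k w + kconv f l w := by
  simp only [kconv, mul_add]
  exact integral_add (integrable_mul_comp_kinDiff hf hk hk' w)
    (integrable_mul_comp_kinDiff hf hl hl' w)

lemma kconv_sum_right {ι : Type*} (s : Finset ι) {f : Phase d → ℝ} {k : ι → Phase d → ℝ}
    (hf : Integrable f) (hk : ∀ i, HasCompactSupport (k i)) (hk' : ∀ i, Continuous (k i))
    (w : Phase d) :
    kconv f (fun y => ∑ i ∈ s, k i y) w = ∑ i ∈ s, kconv f (k i) w := by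
  simp only [kconv, Finset.mul_sum]
  exact integral_finsetSum _ fun i _ => integrable_mul_comp_kinDiff hf (hk i) (hk' i) w

lemma kconv_const_mul_right (c : ℝ) (f k : Phase d → ℝ) (w : Phase d) :
    kconv f (fun y => c * k y) w = c * kconv f k w := by
  simp only [kconv]
  rw [← integral_const_mul]
  congr with z
  ring

lemma kconv_sub_left {f f' k : Phase d → ℝ} (hf : Integrable f) (hf' : Integrable f')
    (hk : HasCompactSupport k) (hk' : Continuous k) (w : Phase d) :
    kconv (f - f') k w = kconv f k w - kconv f' k w := by
  simp only [kconv, Pi.sub_apply, sub_mul]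
  exact integral_sub (integrable_mul_comp_kinDiff hf hk hk' w)
    (integrable_mul_comp_kinDiff hf' hk hk' w)

lemma hasDerivAt_kconv_comp {f k k' : Phase d → ℝ} (hf : Integrable f)
    (hk : HasCompactSupport k) (hkc : Continuous k) (hk' : HasCompactSupport k')
    (hkc' : Continuous k') {γ : ℝ → Phase d}
    (h : ∀ z ε, HasDerivAt (fun ε => k (kinDiff (γ ε) z)) (k' (kinDiff (γ ε) z)) ε) (ε₀ : ℝ) :
    HasDerivAt (fun ε => kconv f k (γ ε)) (kconv f k' (γ ε₀)) ε₀ := by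
  obtain ⟨C, hC⟩ := hk'.exists_bound_of_continuous hkc'
  refine (hasDerivAt_integral_of_dominated_loc_of_deriv_le (bound := fun z => ‖f z‖ * C)
    (F := fun ε z => f z * k (kinDiff (γ ε) z)) (F' := fun ε z => f z * k' (kinDiff (γ ε) z))
    univ_mem
    (Eventually.of_forall fun ε =>
      (integrable_mul_comp_kinDiff hf hk hkc (γ ε)).aestronglyMeasurable)
    (integrable_mul_comp_kinDiff hf hk hkc _)
    (integrable_mul_comp_kinDiff hf hk' hkc' _).aestronglyMeasurable
    (ae_of_all _ fun z ε _ => ?_) (hf.norm.mul_const C)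
    (ae_of_all _ fun z ε _ => (h z ε).const_mul (f z))).2
  rw [norm_mul]
  exact mul_le_mul_of_nonneg_left (hC _) (norm_nonneg _)

/-! ### Invariant vector fields and how the convolution exchanges them. -/

/-- The right-invariant field `∂_t`. -/
noncomputable def derivT (k : Phase d → ℝ) (y : Phase d) : ℝ := fderiv ℝ k y (1, 0, 0)

/-- The right-invariant field `∂_{v_i} + t ∂_{x_i}`. -/
noncomputable def derivV (i : Fin d) (k : Phase d → ℝ) (y : Phase d) : ℝ :=
  fderiv ℝ k y (0, y.1 • EuclideanSpace.single i 1, EuclideanSpace.single i 1)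

lemma contDiff_fderiv_apply {k u} (hk : ContDiff ℝ ∞ k) (hu : ContDiff ℝ ∞ u) :
    ContDiff ℝ ∞ fun y : Phase d => (fderiv ℝ k y : Phase d →L[ℝ] ℝ) (u y) :=
  (hk.fderiv_right (m := ∞) (by simp)).clm_apply hu

lemma contDiff_derivT {k : Phase d → ℝ} (hk : ContDiff ℝ ∞ k) : ContDiff ℝ ∞ (derivT k) :=
  contDiff_fderiv_apply hk contDiff_const

lemma contDiff_derivV {k : Phase d → ℝ} (i : Fin d) (hk : ContDiff ℝ ∞ k) :
    ContDiff ℝ ∞ (derivV i k) :=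
  contDiff_fderiv_apply hk (by fun_prop)

lemma support_fderiv_apply_subset (k : Phase d → ℝ) (u : Phase d → Phase d) :
    Function.support (fun y => fderiv ℝ k y (u y)) ⊆ tsupport k := by
  intro y hy
  apply support_fderiv_subset ℝ
  intro h
  exact hy (by simp [h])

lemma tsupport_derivT_subset (k : Phase d → ℝ) : tsupport (derivT k) ⊆ tsupport k :=
  closure_minimal (support_fderiv_apply_subset k _) (isClosed_tsupport k)

lemma tsupport_derivV_subset (i : Fin d) (k : Phase d → ℝ) :
    tsupport (derivV i k) ⊆ tsupport k :=
  closure_minimal (support_fderiv_apply_subset k _) (isClosed_tsupport k)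

lemma hasCompactSupport_derivT {k : Phase d → ℝ} (hk : HasCompactSupport k) :
    HasCompactSupport (derivT k) :=
  hk.of_isClosed_subset (isClosed_tsupport _) (tsupport_derivT_subset k)

lemma hasCompactSupport_derivV {k : Phase d → ℝ} (i : Fin d) (hk : HasCompactSupport k) :
    HasCompactSupport (derivV i k) :=
  hk.of_isClosed_subset (isClosed_tsupport _) (tsupport_derivV_subset i k)

lemma hasDerivAt_comp_sub_smul {k : Phase d → ℝ} (hk : ContDiff ℝ ∞ k) (y u : Phase d) (ε : ℝ) :
    HasDerivAt (fun ε : ℝ => k (y - ε • u)) (-fderiv ℝ k (y - ε • u) u) ε := by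
  have h1 : HasDerivAt (fun ε : ℝ => y - ε • u) (-u) ε := by
    simpa using ((hasDerivAt_id ε).smul_const u).const_sub y
  have h2 := (hk.differentiable (by simp) (y - ε • u)).hasFDerivAt.comp_hasDerivAt ε h1
  rw [map_neg] at h2
  exact h2

lemma fderiv_kconv_apply {f k k' : Phase d → ℝ} (hf : Integrable f)
    (hk : HasCompactSupport k) (hkc : ContDiff ℝ ∞ k) (hk' : HasCompactSupport k')
    (hkc' : Continuous k') {w u : Phase d}
    (h : ∀ z ε, HasDerivAt (fun ε : ℝ => k (kinDiff (w + ε • u) z))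
      (k' (kinDiff (w + ε • u) z)) ε) :
    fderiv ℝ (kconv f k) w u = kconv f k' w := by
  have h1 := hasDerivAt_kconv_comp hf hk hkc.continuous hk' hkc' h 0
  have h2 : HasDerivAt (fun ε : ℝ => w + ε • u) u 0 := by
    simpa using ((hasDerivAt_id (0 : ℝ)).smul_const u).const_add w
  have h3 := ((contDiff_kconv hf.locallyIntegrable hk hkc).differentiable (by simp)
    (w + (0 : ℝ) • u)).hasFDerivAt.comp_hasDerivAt 0 h2
  have h4 := h3.unique h1
  simpa using h4

lemma transport_kconv {f k : Phase d → ℝ} (hf : Integrable f) (hk : HasCompactSupport k)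
    (hkc : ContDiff ℝ ∞ k) (w : Phase d) :
    transport (kconv f k) w = -kconv f (derivT k) w := by
  have hneg : -kconv f (derivT k) w = kconv f (fun y => -1 * derivT k y) w := by
    rw [kconv_const_mul_right]; ring
  rw [hneg]
  refine fderiv_kconv_apply hf hk hkc (hasCompactSupport_derivT hk).mul_left
    (continuous_const.mul (contDiff_derivT hkc).continuous) fun z ε => ?_
  -- `Y` is left-invariant: its integral curve through `w` is `w ∘ (ε, 0, 0)`, a straight line.
  -- Hence `w⁻¹ ∘ z` gets multiplied on the left by `(-ε, 0, 0)`, which is a flow of `∂_t`.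
  have h : ∀ ε : ℝ, kinDiff (w + ε • ((1, w.2.2, 0) : Phase d)) z =
      kinDiff w z - ε • ((1, 0, 0) : Phase d) := by
    intro ε
    rw [kinDiff_eq, kinDiff_eq]
    ext1
    · simp; ring
    ext1
    · simp; module
    · simp
  simp only [h]
  simpa [derivT] using hasDerivAt_comp_sub_smul hkc (kinDiff w z) (1, 0, 0) ε

lemma gradV_kconv {f k : Phase d → ℝ} (hf : Integrable f) (hk : HasCompactSupport k)
    (hkc : ContDiff ℝ ∞ k) (w : Phase d) (i : Fin d) :
    gradV (kconv f k) w i = -kconv f (derivV i k) w := by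
  have hneg : -kconv f (derivV i k) w = kconv f (fun y => -1 * derivV i k y) w := by
    rw [kconv_const_mul_right]; ring
  rw [hneg]
  refine fderiv_kconv_apply hf hk hkc (hasCompactSupport_derivV i hk).mul_left
    (continuous_const.mul (contDiff_derivV i hkc).continuous) fun z ε => ?_
  -- Here the point moves along `w ∘ (0, 0, ε e_i)`; left multiplication by `(0, 0, -ε e_i)` also
  -- shifts `x` by `-ε t e_i`, whence the term `t ∂_{x_i}` in `derivV`.
  have h : ∀ ε : ℝ, kinDiff (w + ε • ((0, 0, EuclideanSpace.single i 1) : Phase d)) z =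
      kinDiff w z - ε • ((0, (kinDiff w z).1 • EuclideanSpace.single i 1,
        EuclideanSpace.single i 1) : Phase d) := by
    intro ε
    rw [kinDiff_eq, kinDiff_eq]
    ext1
    · simp
    ext1
    · simp; module
    · simp; module
  simp only [h]
  simpa [derivV] using hasDerivAt_comp_sub_smul hkc (kinDiff w z)
    (0, (kinDiff w z).1 • EuclideanSpace.single i 1, EuclideanSpace.single i 1) ε

end KineticNash

/-! ### Dilated kernels and the generator of the dilations. -/

namespace KineticNash

open Filter Topology

variable {d : ℕ}

/-- The `L¹`-normalised kinetic rescaling of a kernel. -/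
noncomputable def kern (k : Phase d → ℝ) (r : ℝ) (y : Phase d) : ℝ :=
  (r ^ (4 * d + 2))⁻¹ * k (kinDil r⁻¹ y)

/-- The generator of the family `kern k r`, up to the factor `-1 / r`. -/
noncomputable def dilGen (k : Phase d → ℝ) (y : Phase d) : ℝ :=
  (4 * d + 2) * k y + fderiv ℝ k y (2 * y.1, (3 : ℝ) • y.2.1, y.2.2)

lemma contDiff_dilGen {k : Phase d → ℝ} (hk : ContDiff ℝ ∞ k) : ContDiff ℝ ∞ (dilGen k) :=
  (contDiff_const.mul hk).add (contDiff_fderiv_apply hk (by fun_prop))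

lemma hasCompactSupport_dilGen {k : Phase d → ℝ} (hk : HasCompactSupport k) :
    HasCompactSupport (dilGen k) := by
  refine hk.mul_left.add ?_
  exact hk.of_isClosed_subset (isClosed_tsupport _)
    (closure_minimal (support_fderiv_apply_subset k _) (isClosed_tsupport k))

lemma contDiff_kern {k : Phase d → ℝ} (hk : ContDiff ℝ ∞ k) (r : ℝ) :
    ContDiff ℝ ∞ (kern k r) :=
  contDiff_const.mul (hk.comp (dilCLM d r⁻¹).contDiff)

lemma tsupport_kern_subset {k : Phase d → ℝ} (hk : HasCompactSupport k) {r : ℝ} (hr : r ≠ 0) :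
    tsupport (kern k r) ⊆ setDil r (tsupport k) := by
  refine closure_minimal (fun y hy => ?_)
    (hk.image (dilCLM d r).continuous).isClosed
  exact ⟨kinDil r⁻¹ y, subset_tsupport _ (right_ne_zero_of_mul hy), kinDil_inv_cancel hr y⟩

lemma hasCompactSupport_kern {k : Phase d → ℝ} (hk : HasCompactSupport k) {r : ℝ} (hr : r ≠ 0) :
    HasCompactSupport (kern k r) :=
  (hk.image (dilCLM d r).continuous).of_isClosed_subset (isClosed_tsupport _)
    (tsupport_kern_subset hk hr)

lemma isOpen_setDil {U : Set (Phase d)} (hU : IsOpen U) {r : ℝ} (hr : r ≠ 0) :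
    IsOpen (setDil r U) := by
  have : setDil r U = kinDil r⁻¹ ⁻¹' U := by
    ext y
    constructor
    · rintro ⟨b, hb, rfl⟩
      rwa [mem_preimage, kinDil_cancel_inv hr]
    · exact fun h => ⟨_, h, kinDil_inv_cancel hr y⟩
  rw [this]
  exact hU.preimage (dilCLM d r⁻¹).continuous

lemma fderiv_kern {k : Phase d → ℝ} (hk : ContDiff ℝ ∞ k) (r : ℝ) (y u : Phase d) :
    fderiv ℝ (kern k r) y u =
      (r ^ (4 * d + 2))⁻¹ * fderiv ℝ k (kinDil r⁻¹ y) (kinDil r⁻¹ u) := by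
  have h1 := ((hk.differentiable (by simp) (dilCLM d r⁻¹ y)).hasFDerivAt.comp y
    (dilCLM d r⁻¹).hasFDerivAt).const_mul ((r ^ (4 * d + 2))⁻¹)
  have h2 : HasFDerivAt (kern k r) _ y := h1
  rw [h2.fderiv]
  rfl

lemma derivT_kern {k : Phase d → ℝ} (hk : ContDiff ℝ ∞ k) (r : ℝ) (y : Phase d) :
    derivT (kern k r) y = r⁻¹ ^ 2 * kern (derivT k) r y := by
  have : kinDil r⁻¹ ((1, 0, 0) : Phase d) = (r⁻¹ ^ 2) • (1, 0, 0) := by simp [kinDil]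
  rw [derivT, fderiv_kern hk, this, map_smul, kern, derivT, smul_eq_mul]
  ring

lemma derivV_kern {k : Phase d → ℝ} (hk : ContDiff ℝ ∞ k) (i : Fin d) (r : ℝ) (y : Phase d) :
    derivV i (kern k r) y = r⁻¹ * kern (derivV i k) r y := by
  have : kinDil r⁻¹ ((0, y.1 • EuclideanSpace.single i 1, EuclideanSpace.single i 1) : Phase d) =
      r⁻¹ • (0, (kinDil r⁻¹ y).1 • EuclideanSpace.single i 1, EuclideanSpace.single i 1) := by
    ext1
    · simp [kinDil]
    ext1
    · simp only [kinDil, smul_smul, Prod.smul_mk]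
      congr 1
      ring
    · simp [kinDil]
  rw [derivV, fderiv_kern hk, this, map_smul, kern, derivV, smul_eq_mul]
  ring

lemma hasDerivAt_kern {k : Phase d → ℝ} (hk : ContDiff ℝ ∞ k) {r : ℝ} (hr : r ≠ 0)
    (y : Phase d) :
    HasDerivAt (fun r => kern k r y) (-r⁻¹ * kern (dilGen k) r y) r := by
  have hi : HasDerivAt (fun r : ℝ => r⁻¹) (-(r ^ 2)⁻¹) r := hasDerivAt_inv hr
  have hdil : HasDerivAt (fun r : ℝ => kinDil r⁻¹ y)
      (-r⁻¹ • (2 * (kinDil r⁻¹ y).1, (3 : ℝ) • (kinDil r⁻¹ y).2.1, (kinDil r⁻¹ y).2.2)) r := by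
    have h := ((hi.pow 2).mul_const y.1).prodMk
      (((hi.pow 3).smul_const y.2.1).prodMk (hi.smul_const y.2.2))
    refine h.congr_deriv ?_
    ext1
    · simp [kinDil]; field_simp
    ext1
    · simp only [kinDil, Prod.smul_mk, smul_smul]
      congr 1
      push_cast
      field_simp
    · simp only [kinDil, Prod.smul_mk, smul_smul]
      congr 1
      field_simp
  have h1 := (hk.differentiable (by simp) (kinDil r⁻¹ y)).hasFDerivAt.comp_hasDerivAt r hdil
  have h2 : HasDerivAt (fun r : ℝ => (r ^ (4 * d + 2))⁻¹)
      (-r⁻¹ * (4 * d + 2) * (r ^ (4 * d + 2))⁻¹) r := by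
    refine ((hasDerivAt_pow (4 * d + 2) r).inv (pow_ne_zero _ hr)).congr_deriv ?_
    rw [show 4 * d + 2 - 1 = 4 * d + 1 by omega, show r ^ (4 * d + 2) = r ^ (4 * d + 1) * r by ring]
    push_cast
    field_simp
  refine (h2.mul h1).congr_deriv ?_
  simp only [map_smul, smul_eq_mul, kern, dilGen, Function.comp]
  ring

lemma map_kinDil_inv {r : ℝ} (hr : 0 < r) :
    (volume : Measure (Phase d)).map (kinDil r⁻¹) =
      ENNReal.ofReal (r ^ (4 * d + 2)) • volume := by
  have hdet : LinearMap.det (dilCLM d r⁻¹ : Phase d →ₗ[ℝ] Phase d) ≠ 0 := by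
    rw [det_dilCLM]; positivity
  have h := Measure.map_linearMap_addHaar_eq_smul_addHaar (volume : Measure (Phase d)) hdet
  rwa [det_dilCLM, inv_pow, inv_inv, abs_of_pos (by positivity)] at h

/-- This keeps the constants in Young's inequality independent of `r`. -/
lemma eLpNorm_kern_one {k : Phase d → ℝ} (hk : Continuous k) {r : ℝ} (hr : 0 < r) :
    eLpNorm (kern k r) 1 volume = eLpNorm k 1 volume := by
  have hm : Measurable (kinDil r⁻¹ : Phase d → Phase d) := (dilCLM d r⁻¹).continuous.measurable
  have hpos : 0 < r ^ (4 * d + 2) := by positivity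
  simp only [eLpNorm_one_eq_lintegral_enorm, kern, enorm_mul]
  rw [lintegral_const_mul _ (by exact (hk.measurable.comp hm).enorm),
    ← lintegral_map (f := fun y => ‖k y‖ₑ) hk.measurable.enorm hm, map_kinDil_inv hr,
    lintegral_smul_measure, smul_eq_mul, ← mul_assoc, Real.enorm_eq_ofReal (by positivity),
    ← ENNReal.ofReal_mul (by positivity), inv_mul_cancel₀ hpos.ne']
  simp

/-! ### The generator as a divergence along `∂_t` and `∂_{v_i} + t ∂_{x_i}`. -/

section Decomposition

variable (φ : Phase d → ℝ)

/-- The potential whose `x_i`-derivative corrects the `i`-th component in the decomposition of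
`dilGen φ`. -/
noncomputable def potX (i : Fin d) (y : Phase d) : ℝ := (3 * y.2.1 i - y.1 * y.2.2 i) * φ y

/-- The `∂_t`-component in the decomposition of `dilGen φ`. -/
noncomputable def compT (y : Phase d) : ℝ := 2 * y.1 * φ y + ∑ i, derivV i (potX φ i) y

/-- The `∂_{v_i} + t ∂_{x_i}`-component in the decomposition of `dilGen φ`. -/
noncomputable def compV (i : Fin d) (y : Phase d) : ℝ := y.2.2 i * φ y - derivT (potX φ i) y

variable {φ}

lemma contDiff_potX (hφ : ContDiff ℝ ∞ φ) (i : Fin d) : ContDiff ℝ ∞ (potX φ i) := by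
  unfold potX
  fun_prop

lemma contDiff_compT (hφ : ContDiff ℝ ∞ φ) : ContDiff ℝ ∞ (compT φ) := by
  have := fun i => contDiff_derivV i (contDiff_potX hφ i)
  unfold compT
  fun_prop

lemma contDiff_compV (hφ : ContDiff ℝ ∞ φ) (i : Fin d) : ContDiff ℝ ∞ (compV φ i) := by
  have := contDiff_derivT (contDiff_potX hφ i)
  unfold compV
  fun_prop

lemma tsupport_potX_subset (i : Fin d) : tsupport (potX φ i) ⊆ tsupport φ :=
  closure_mono fun _ hy => right_ne_zero_of_mul hy

lemma tsupport_compT_subset : tsupport (compT φ) ⊆ tsupport φ := by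
  refine closure_minimal (fun y hy => ?_) (isClosed_tsupport _)
  by_contra h
  refine hy ?_
  have h1 : φ y = 0 := image_eq_zero_of_notMem_tsupport h
  have h2 : ∀ i, derivV i (potX φ i) y = 0 := fun i => image_eq_zero_of_notMem_tsupport
    fun h' => h (tsupport_potX_subset i (tsupport_derivV_subset i _ h'))
  simp [compT, h1, h2]

lemma tsupport_compV_subset (i : Fin d) : tsupport (compV φ i) ⊆ tsupport φ := by
  refine closure_minimal (fun y hy => ?_) (isClosed_tsupport _)
  by_contra h
  refine hy ?_
  have h1 : φ y = 0 := image_eq_zero_of_notMem_tsupport h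
  have h2 : derivT (potX φ i) y = 0 := image_eq_zero_of_notMem_tsupport
    fun h' => h (tsupport_potX_subset i (tsupport_derivT_subset _ h'))
  simp [compV, h1, h2]

/-- The Hörmander commutator. Second derivatives cancel by symmetry, and only `∂_t` falling on the
coefficient `t` of `∂_{x_i}` survives. -/
lemma derivT_derivV_sub (i : Fin d) {k : Phase d → ℝ} (hk : ContDiff ℝ ∞ k) (y : Phase d) :
    derivT (derivV i k) y - derivV i (derivT k) y =
      fderiv ℝ k y (0, EuclideanSpace.single i 1, 0) := by
  have hs : IsSymmSndFDerivAt ℝ k y :=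
    hk.contDiffAt.isSymmSndFDerivAt (by
      rw [minSmoothness_of_isRCLikeNormedField]
      exact WithTop.coe_le_coe.2 (le_top : (2 : ℕ∞) ≤ ⊤))
  have hd : HasFDerivAt (fderiv ℝ k) (fderiv ℝ (fderiv ℝ k) y) y :=
    ((hk.fderiv_right (m := ∞) (by simp)).differentiable (by simp) y).hasFDerivAt
  let e : Vec d := EuclideanSpace.single i 1
  have hu : HasFDerivAt (fun y : Phase d => ((0, y.1 • e, e) : Phase d))
      ((0 : Phase d →L[ℝ] ℝ).prod (((ContinuousLinearMap.fst ℝ ℝ (Vec d × Vec d)).smulRight e).prod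
        (0 : Phase d →L[ℝ] Vec d))) y :=
    (hasFDerivAt_const _ _).prodMk
      ((((ContinuousLinearMap.fst ℝ ℝ (Vec d × Vec d)).smulRight e).hasFDerivAt).prodMk
        (hasFDerivAt_const _ _))
  have h1 : HasFDerivAt (derivV i k) _ y := hd.clm_apply hu
  have h2 : HasFDerivAt (derivT k) _ y := hd.clm_apply (hasFDerivAt_const (1, 0, 0) y)
  rw [derivT, h1.fderiv, derivV, h2.fderiv]
  have := hs (1, 0, 0) (0, y.1 • e, e)
  simp only [e] at this
  simp [e, this]

/-- The coordinate `x_i` as a continuous linear functional. -/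
noncomputable def coordX (i : Fin d) : Phase d →L[ℝ] ℝ :=
  (EuclideanSpace.proj i).comp
    ((ContinuousLinearMap.fst ℝ (Vec d) (Vec d)).comp (ContinuousLinearMap.snd ℝ ℝ (Vec d × Vec d)))

/-- The coordinate `v_i` as a continuous linear functional. -/
noncomputable def coordV (i : Fin d) : Phase d →L[ℝ] ℝ :=
  (EuclideanSpace.proj i).comp
    ((ContinuousLinearMap.snd ℝ (Vec d) (Vec d)).comp (ContinuousLinearMap.snd ℝ ℝ (Vec d × Vec d)))

lemma fderiv_mul_apply {a k : Phase d → ℝ} {a' : Phase d →L[ℝ] ℝ} (hk : ContDiff ℝ ∞ k)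
    {y : Phase d} (ha : HasFDerivAt a a' y) (u : Phase d) :
    fderiv ℝ (fun y => a y * k y) y u = a y * fderiv ℝ k y u + k y * a' u := by
  have h : HasFDerivAt (fun y => a y * k y) _ y :=
    ha.mul (hk.differentiable (by simp) y).hasFDerivAt
  rw [h.fderiv]
  simp

lemma sum_smul_single (x : Vec d) : ∑ i, x i • EuclideanSpace.single i (1 : ℝ) = x := by
  simpa using (EuclideanSpace.basisFun (Fin d) ℝ).sum_repr x

/-- As `4d + 2` is the divergence of the dilation field, `dilGen φ = ∂_t (2tφ) + ∑ ∂_{x_i}(3x_i φ) +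
∑ ∂_{v_i}(v_i φ)`. Replacing `∂_{v_i}` by `V_i - t ∂_{x_i}` leaves `∂_{x_i}` of `potX φ i = (3x_i -
t v_i) φ`, and the commutator splits this into `∂_t (V_i potX) - V_i (∂_t potX)`. -/
lemma dilGen_eq (hφ : ContDiff ℝ ∞ φ) (y : Phase d) :
    dilGen φ y = derivT (compT φ) y + ∑ i, derivV i (compV φ i) y := by
  have hdiff : ∀ {k : Phase d → ℝ}, ContDiff ℝ ∞ k → DifferentiableAt ℝ k y :=
    fun hk => hk.differentiable (by simp) y
  have hp := contDiff_potX hφ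
  have h1 : derivT (compT φ) y = 2 * y.1 * derivT φ y + 2 * φ y +
      ∑ i, derivT (derivV i (potX φ i)) y := by
    have ha : HasFDerivAt (fun y : Phase d => 2 * y.1)
        ((2 : ℝ) • ContinuousLinearMap.fst ℝ ℝ (Vec d × Vec d)) y :=
      (ContinuousLinearMap.fst ℝ ℝ (Vec d × Vec d)).hasFDerivAt.const_mul 2
    have hs : HasFDerivAt (fun y => ∑ i, derivV i (potX φ i) y)
        (∑ i, fderiv ℝ (derivV i (potX φ i)) y) y :=
      HasFDerivAt.fun_sum fun i _ => (hdiff (contDiff_derivV i (hp i))).hasFDerivAt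
    have hc : HasFDerivAt (compT φ) _ y :=
      (hdiff (((contDiff_const.mul contDiff_fst).mul hφ :
        ContDiff ℝ ∞ fun y : Phase d => 2 * y.1 * φ y))).hasFDerivAt.add hs
    rw [derivT, hc.fderiv, add_apply, fderiv_mul_apply hφ ha,
      sum_apply]
    simp only [derivT, smul_apply, ContinuousLinearMap.coe_fst', smul_eq_mul]
    ring
  have h2 : ∀ i, derivV i (compV φ i) y = y.2.2 i * derivV i φ y + φ y -
      derivV i (derivT (potX φ i)) y := by
    intro i
    have ha : HasFDerivAt (fun y : Phase d => y.2.2 i) (coordV i) y := (coordV i).hasFDerivAt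
    have hc : HasFDerivAt (compV φ i) _ y :=
      (hdiff (((coordV i).contDiff.mul hφ : ContDiff ℝ ∞ fun y : Phase d => y.2.2 i * φ y))
        ).hasFDerivAt.sub (hdiff (contDiff_derivT (hp i))).hasFDerivAt
    rw [derivV, hc.fderiv, sub_apply]
    erw [fderiv_mul_apply hφ ha]
    simp [derivV, coordV]
  have h3 : ∀ i, fderiv ℝ (potX φ i) y (0, EuclideanSpace.single i 1, 0) =
      (3 * y.2.1 i - y.1 * y.2.2 i) * fderiv ℝ φ y (0, EuclideanSpace.single i 1, 0) +
        3 * φ y := by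
    intro i
    have ha : HasFDerivAt (fun y : Phase d => 3 * y.2.1 i - y.1 * y.2.2 i)
        ((3 : ℝ) • coordX i - (y.1 • coordV i +
          y.2.2 i • ContinuousLinearMap.fst ℝ ℝ (Vec d × Vec d))) y :=
      ((coordX i).hasFDerivAt.const_mul 3).sub
        ((ContinuousLinearMap.fst ℝ ℝ (Vec d × Vec d)).hasFDerivAt.mul (coordV i).hasFDerivAt)
    have := fderiv_mul_apply hφ ha (0, EuclideanSpace.single i 1, 0)
    rw [show potX φ i = fun y => (3 * y.2.1 i - y.1 * y.2.2 i) * φ y from rfl, this]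
    simp [coordX, coordV]
    ring
  have h4 : ∀ i, derivV i φ y = y.1 * fderiv ℝ φ y (0, EuclideanSpace.single i 1, 0) +
      fderiv ℝ φ y (0, 0, EuclideanSpace.single i 1) := by
    intro i
    rw [derivV, ← smul_eq_mul, ← map_smul, ← map_add]
    simp
  have h5 : fderiv ℝ φ y (2 * y.1, (3 : ℝ) • y.2.1, y.2.2) = 2 * y.1 * derivT φ y +
      ∑ i, (3 * y.2.1 i * fderiv ℝ φ y (0, EuclideanSpace.single i 1, 0) +
        y.2.2 i * fderiv ℝ φ y (0, 0, EuclideanSpace.single i 1)) := by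
    simp only [derivT, ← smul_eq_mul (_ : ℝ) (fderiv ℝ φ y _), ← map_smul, ← map_add, ← map_sum]
    congr 1
    ext1
    · simp [Prod.fst_sum]
    ext1
    · simp only [Prod.smul_mk, Prod.snd_add, Prod.fst_add, Prod.snd_sum, Prod.fst_sum,
        smul_zero, add_zero, zero_add, ← smul_smul, ← Finset.smul_sum]
      rw [sum_smul_single]
    · simp only [Prod.smul_mk, Prod.snd_add, Prod.snd_sum, smul_zero, zero_add]
      rw [sum_smul_single]
  have h6 : ∀ i, derivT (derivV i (potX φ i)) y + derivV i (compV φ i) y =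
      (3 * y.2.1 i * fderiv ℝ φ y (0, EuclideanSpace.single i 1, 0) +
        y.2.2 i * fderiv ℝ φ y (0, 0, EuclideanSpace.single i 1)) + 4 * φ y := by
    intro i
    have h7 := derivT_derivV_sub i (hp i) y
    rw [h2 i, h4 i]
    rw [h3 i] at h7
    linear_combination h7
  have h8 := Finset.sum_congr (rfl : (Finset.univ : Finset (Fin d)) = _) fun i _ => h6 i
  rw [Finset.sum_add_distrib, Finset.sum_add_distrib] at h8
  simp only [Finset.sum_const, Finset.card_univ, Fintype.card_fin, nsmul_eq_mul] at h8
  rw [dilGen, h5, h1]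
  linear_combination -h8

end Decomposition

end KineticNash

/-! ### Cauchy–Schwarz and Young inequalities. -/

namespace KineticNash

open Filter Topology

section CauchySchwarz

variable {α : Type*} [MeasurableSpace α] {μ : Measure α}

lemma eLpNorm_two_sq {E : Type*} [NormedAddCommGroup E] (a : α → E) :
    eLpNorm a 2 μ ^ 2 = ∫⁻ x, ‖a x‖ₑ ^ 2 ∂μ := by
  have := eLpNorm_nnreal_pow_eq_lintegral (μ := μ) (f := a) (p := 2) (by norm_num)
  simpa using this

lemma lintegral_mul_le_eLpNorm_two {E F : Type*} [NormedAddCommGroup E] [NormedAddCommGroup F]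
    {a : α → E} {b : α → F} (ha : AEStronglyMeasurable a μ) (hb : AEStronglyMeasurable b μ) :
    ∫⁻ x, ‖a x‖ₑ * ‖b x‖ₑ ∂μ ≤ eLpNorm a 2 μ * eLpNorm b 2 μ := by
  have h := ENNReal.lintegral_mul_le_Lp_mul_Lq μ Real.HolderConjugate.two_two ha.enorm hb.enorm
  rw [eLpNorm_eq_lintegral_rpow_enorm_toReal (by norm_num) (by norm_num),
    eLpNorm_eq_lintegral_rpow_enorm_toReal (by norm_num) (by norm_num)]
  simpa using h

lemma enorm_integral_mul_le {a b : α → ℝ} (ha : AEStronglyMeasurable a μ)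
    (hb : AEStronglyMeasurable b μ) :
    ‖∫ x, a x * b x ∂μ‖ₑ ≤ eLpNorm a 2 μ * eLpNorm b 2 μ := by
  refine (enorm_integral_le_lintegral_enorm _).trans ?_
  simp only [enorm_mul]
  exact lintegral_mul_le_eLpNorm_two ha hb

lemma sq_lintegral_mul_le {a b : α → ℝ≥0∞} (ha : AEMeasurable a μ) (hb : AEMeasurable b μ) :
    (∫⁻ x, a x * b x ∂μ) ^ 2 ≤ (∫⁻ x, a x ^ 2 * b x ∂μ) * ∫⁻ x, b x ∂μ := by
  have hs : ∀ x, b x ^ (1 / 2 : ℝ) * b x ^ (1 / 2 : ℝ) = b x := fun x => by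
    rw [← ENNReal.rpow_add_of_nonneg _ _ (by norm_num) (by norm_num)]
    norm_num
  have hq : ∀ c : ℝ≥0∞, (c ^ (1 / 2 : ℝ)) ^ 2 = c := fun c => by
    rw [← ENNReal.rpow_natCast, ← ENNReal.rpow_mul]
    norm_num
  have h := ENNReal.lintegral_mul_le_Lp_mul_Lq μ Real.HolderConjugate.two_two
    (ha.mul (hb.pow_const (1 / 2 : ℝ))) (hb.pow_const (1 / 2 : ℝ))
  simp only [Pi.mul_apply, mul_assoc, hs] at h
  refine (pow_le_pow_left' h 2).trans_eq ?_
  rw [mul_pow, hq, hq]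
  simp only [ENNReal.rpow_two, mul_pow, hq]

end CauchySchwarz

variable {d : ℕ}

/-- Schur's test: Cauchy–Schwarz with weight `|k (w⁻¹ ∘ z)|`, whose integrals in `z` and in `w` both
equal `‖k‖_{L¹}`. -/
lemma eLpNorm_kconv_le {f k : Phase d → ℝ} (hf : AEStronglyMeasurable f volume)
    (hk : Continuous k) :
    eLpNorm (kconv f k) 2 volume ≤ eLpNorm k 1 volume * eLpNorm f 2 volume := by
  have hm : Measurable fun p : Phase d × Phase d => ‖k (kinDiff p.1 p.2)‖ₑ :=
    (hk.comp continuous_kinDiff).measurable.enorm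
  have h1 : ∀ w, ∫⁻ z, ‖k (kinDiff w z)‖ₑ = eLpNorm k 1 volume := fun w => by
    rw [eLpNorm_one_eq_lintegral_enorm]
    exact (measurePreserving_kinDiff_right w).lintegral_comp hk.measurable.enorm
  have h2 : ∀ z, ∫⁻ w, ‖k (kinDiff w z)‖ₑ = eLpNorm k 1 volume := fun z => by
    rw [eLpNorm_one_eq_lintegral_enorm]
    exact (measurePreserving_kinDiff_left z).lintegral_comp hk.measurable.enorm
  have h3 : ∀ w, ‖kconv f k w‖ₑ ^ 2 ≤
      (∫⁻ z, ‖f z‖ₑ ^ 2 * ‖k (kinDiff w z)‖ₑ) * eLpNorm k 1 volume := fun w => by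
    rw [← h1 w]
    refine (pow_le_pow_left' ((enorm_integral_le_lintegral_enorm _).trans_eq ?_) 2).trans
      (sq_lintegral_mul_le hf.enorm (hm.comp measurable_prodMk_left).aemeasurable)
    simp only [enorm_mul]
  rw [← ENNReal.pow_le_pow_left_iff two_ne_zero, eLpNorm_two_sq, mul_pow, eLpNorm_two_sq]
  have hm2 : AEMeasurable (fun p : Phase d × Phase d => ‖f p.2‖ₑ ^ 2 * ‖k (kinDiff p.1 p.2)‖ₑ)
      (volume.prod volume) :=
    ((hf.comp_snd (μ := (volume : Measure (Phase d)))).enorm.pow_const 2).mul hm.aemeasurable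
  calc ∫⁻ w, ‖kconv f k w‖ₑ ^ 2
      ≤ ∫⁻ w, (∫⁻ z, ‖f z‖ₑ ^ 2 * ‖k (kinDiff w z)‖ₑ) * eLpNorm k 1 volume := lintegral_mono h3
    _ = (∫⁻ w, ∫⁻ z, ‖f z‖ₑ ^ 2 * ‖k (kinDiff w z)‖ₑ) * eLpNorm k 1 volume :=
        lintegral_mul_const'' _ hm2.lintegral_prod_right'
    _ = (∫⁻ z, ∫⁻ w, ‖f z‖ₑ ^ 2 * ‖k (kinDiff w z)‖ₑ) * eLpNorm k 1 volume := by
        rw [lintegral_lintegral_swap hm2]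
    _ = (∫⁻ z, ‖f z‖ₑ ^ 2 * eLpNorm k 1 volume) * eLpNorm k 1 volume := by
        congr 2 with z
        rw [lintegral_const_mul _ (by exact hm.comp measurable_prodMk_right), h2]
    _ = eLpNorm k 1 volume ^ 2 * ∫⁻ z, ‖f z‖ₑ ^ 2 := by
        rw [lintegral_mul_const'' _ (hf.enorm.pow_const 2)]
        ring

lemma enorm_integral_mul_kconv_le {f g k : Phase d → ℝ} {C : ℝ}
    (hk : ∀ y, ‖k y‖ ≤ C) (hf : AEStronglyMeasurable f volume)
    (hg : AEStronglyMeasurable g volume) :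
    ‖∫ w, g w * kconv f k w‖ₑ ≤
      ENNReal.ofReal C * (eLpNorm f 1 volume * eLpNorm g 1 volume) := by
  have h1 : ∀ w, ‖kconv f k w‖ₑ ≤ ENNReal.ofReal C * eLpNorm f 1 volume := fun w => by
    refine (enorm_integral_le_lintegral_enorm _).trans ?_
    rw [eLpNorm_one_eq_lintegral_enorm, ← lintegral_const_mul'' _ hf.enorm]
    refine lintegral_mono fun z => ?_
    rw [enorm_mul, mul_comm]
    gcongr
    rw [← ofReal_norm]
    exact ENNReal.ofReal_le_ofReal (hk _)
  refine (enorm_integral_le_lintegral_enorm _).trans ?_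
  rw [← mul_assoc, eLpNorm_one_eq_lintegral_enorm (f := g), ← lintegral_const_mul'' _ hg.enorm]
  refine lintegral_mono fun w => ?_
  rw [enorm_mul, mul_comm]
  gcongr
  exact h1 w

/-! ### Differentiating the pairing in the scale `r`. -/

section Pairing

variable {f g : Phase d → ℝ}

lemma integrable_indicator_mul_prod (hg : LocallyIntegrable g) (hf : Integrable f)
    {K : Set (Phase d)} (hK : IsCompact K) :
    Integrable (fun p : Phase d × Phase d => K.indicator g p.1 * f p.2)
      (volume.prod volume) :=
  (((hg.integrableOn_isCompact hK).integrable_indicator hK.measurableSet)).mul_prod hf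

/-- The integrand vanishes unless `w` lies in the compact set `tsupport f ∘ (tsupport k)⁻¹`, so
local integrability of `g` is enough. -/
lemma integrable_pairing (hg : LocallyIntegrable g) (hf : Integrable f)
    (hfc : HasCompactSupport f) {k : Phase d → ℝ} (hk : HasCompactSupport k)
    (hk' : Continuous k) :
    Integrable (fun p : Phase d × Phase d => g p.1 * (f p.2 * k (kinDiff p.1 p.2)))
      (volume.prod volume) := by
  obtain ⟨C, hC⟩ := hk.exists_bound_of_continuous hk'
  have h := (integrable_indicator_mul_prod hg hf (isCompact_setMul_setInv hfc hk)).mul_bdd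
    (g := fun p : Phase d × Phase d => k (kinDiff p.1 p.2))
    (hk'.comp continuous_kinDiff).aestronglyMeasurable (ae_of_all _ fun p => hC _)
  refine h.congr (ae_of_all _ fun p => ?_)
  simp only [mul_assoc]
  by_cases h1 : f p.2 * k (kinDiff p.1 p.2) = 0
  · simp [h1]
  obtain ⟨h2, h3⟩ := mul_ne_zero_iff.1 h1
  rw [indicator_of_mem]
  exact mem_setMul_setInv.2 ⟨p.2, subset_tsupport _ h2, subset_tsupport _ h3⟩

lemma integral_pairing (hg : LocallyIntegrable g) (hf : Integrable f)
    (hfc : HasCompactSupport f) {k : Phase d → ℝ} (hk : HasCompactSupport k)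
    (hk' : Continuous k) :
    ∫ p : Phase d × Phase d, g p.1 * (f p.2 * k (kinDiff p.1 p.2)) ∂(volume.prod volume) =
      ∫ w, g w * kconv f k w := by
  rw [integral_prod _ (integrable_pairing hg hf hfc hk hk')]
  simp only [integral_const_mul, kconv]

lemma hasDerivAt_pairing (hg : LocallyIntegrable g) (hf : Integrable f)
    (hfc : HasCompactSupport f) {φ : Phase d → ℝ} (hφ : HasCompactSupport φ)
    (hφ' : ContDiff ℝ ∞ φ) {r₀ : ℝ} (hr₀ : 0 < r₀) :
    HasDerivAt (fun r => ∫ w, g w * kconv f (kern φ r) w)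
      (-r₀⁻¹ * ∫ w, g w * kconv f (kern (dilGen φ) r₀) w) r₀ := by
  have hψ := hasCompactSupport_dilGen hφ
  have hψ' := contDiff_dilGen hφ'
  obtain ⟨C, hC⟩ := hψ.exists_bound_of_continuous hψ'.continuous
  let s := Ioo (r₀ / 2) (2 * r₀)
  have hs : s ∈ 𝓝 r₀ := Ioo_mem_nhds (by linarith) (by linarith)
  have hpos : ∀ r ∈ s, 0 < r := fun r hr => by have := hr.1; linarith
  -- Compactness of the union of the dilated supports over `r ∈ [r₀/2, 2r₀]` gives one compact `K`
  -- that works for all nearby `r`; `M` bounds the differentiated kernel there, since its negative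
  -- powers of `r` are largest at `r₀/2`.
  let D : Set (Phase d) :=
    (fun p : ℝ × Phase d => kinDil p.1 p.2) '' (Icc (r₀ / 2) (2 * r₀) ×ˢ tsupport (dilGen φ))
  have hD : IsCompact D := (isCompact_Icc.prod hψ).image continuous_kinDil
  let K := setMul (tsupport f) (setInv D)
  have hK : IsCompact K := isCompact_setMul_setInv hfc hD
  let M := (r₀ / 2)⁻¹ * (((r₀ / 2) ^ (4 * d + 2))⁻¹ * C)
  have h := hasDerivAt_integral_of_dominated_loc_of_deriv_le
    (μ := (volume : Measure (Phase d)).prod (volume : Measure (Phase d)))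
    (bound := fun p => ‖K.indicator g p.1 * f p.2‖ * M)
    (F := fun r p => g p.1 * (f p.2 * kern φ r (kinDiff p.1 p.2)))
    (F' := fun r p => g p.1 * (f p.2 * (-r⁻¹ * kern (dilGen φ) r (kinDiff p.1 p.2)))) hs
    (by
      filter_upwards [hs] with r hr
      exact (integrable_pairing hg hf hfc (hasCompactSupport_kern hφ (hpos r hr).ne')
        (contDiff_kern hφ' r).continuous).aestronglyMeasurable)
    (integrable_pairing hg hf hfc (hasCompactSupport_kern hφ hr₀.ne')
        (contDiff_kern hφ' r₀).continuous)
    (integrable_pairing (k := fun y => -r₀⁻¹ * kern (dilGen φ) r₀ y) hg hf hfc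
      (hasCompactSupport_kern hψ hr₀.ne').mul_left
      (continuous_const.mul (contDiff_kern hψ' r₀).continuous)).aestronglyMeasurable
    (ae_of_all _ fun p r hr => by
      have hr' := hpos r hr
      by_cases h1 : f p.2 * kern (dilGen φ) r (kinDiff p.1 p.2) = 0
      · have : g p.1 * (f p.2 * (-r⁻¹ * kern (dilGen φ) r (kinDiff p.1 p.2))) =
          -r⁻¹ * g p.1 * (f p.2 * kern (dilGen φ) r (kinDiff p.1 p.2)) := by ring
        rw [this, h1, mul_zero, norm_zero]
        have : 0 ≤ C := (norm_nonneg _).trans (hC 0)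
        positivity
      obtain ⟨h2, h3⟩ := mul_ne_zero_iff.1 h1
      have hmem : p.1 ∈ K := mem_setMul_setInv.2 ⟨p.2, subset_tsupport _ h2,
        (r, kinDil r⁻¹ (kinDiff p.1 p.2)),
        ⟨Ioo_subset_Icc_self hr, subset_tsupport _ (right_ne_zero_of_mul h3)⟩,
        kinDil_inv_cancel hr'.ne' _⟩
      rw [indicator_of_mem hmem, ← mul_assoc, norm_mul]
      refine mul_le_mul_of_nonneg_left ?_ (norm_nonneg _)
      rw [kern, norm_mul, norm_mul, norm_neg, Real.norm_of_nonneg (by positivity : 0 ≤ r⁻¹),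
        Real.norm_of_nonneg (by positivity : 0 ≤ (r ^ (4 * d + 2))⁻¹)]
      have hle : r₀ / 2 ≤ r := hr.1.le
      have := hC (kinDil r⁻¹ (kinDiff p.1 p.2))
      dsimp only [M]
      gcongr)
    ((integrable_indicator_mul_prod hg hf hK).norm.mul_const M)
    (ae_of_all _ fun p r hr =>
      ((hasDerivAt_kern hφ' (hpos r hr).ne' _).const_mul (f p.2)).const_mul (g p.1))
  have h2 := h.2
  rw [integral_pairing (k := fun y => -r₀⁻¹ * kern (dilGen φ) r₀ y) hg hf hfc
    (hasCompactSupport_kern hψ hr₀.ne').mul_left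
    (continuous_const.mul (contDiff_kern hψ' r₀).continuous)] at h2
  have h3 : ∫ w, g w * kconv f (fun y => -r₀⁻¹ * kern (dilGen φ) r₀ y) w =
      -r₀⁻¹ * ∫ w, g w * kconv f (kern (dilGen φ) r₀) w := by
    rw [← integral_const_mul]
    congr 1 with w
    rw [kconv_const_mul_right]
    ring
  rw [h3] at h2
  refine h2.congr_of_eventuallyEq ?_
  filter_upwards [hs] with r hr
  exact (integral_pairing hg hf hfc (hasCompactSupport_kern hφ (hpos r hr).ne')
    (contDiff_kern hφ' r).continuous).symm

end Pairing

end KineticNash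

/-! ### The pairing as the scale tends to zero. -/

namespace KineticNash

open Filter Topology

variable {d : ℕ}

lemma integrable_mul_kconv {f g : Phase d → ℝ} (hg : LocallyIntegrable g) (hf : Integrable f)
    (hfc : HasCompactSupport f) {k : Phase d → ℝ} (hk : HasCompactSupport k)
    (hk' : Continuous k) : Integrable fun w => g w * kconv f k w := by
  have h := (integrable_pairing hg hf hfc hk hk').integral_prod_left
  simp only [integral_const_mul] at h
  exact h

lemma kconv_kern_eq {f φ : Phase d → ℝ} (hf : Continuous f) (hφ : Continuous φ) {r : ℝ}
    (hr : 0 < r) (w : Phase d) :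
    kconv f (kern φ r) w = ∫ b, f (kinMul w (kinDil r b)) * φ b := by
  have hpos : 0 < r ^ (4 * d + 2) := by positivity
  have hmul : Continuous fun y : Phase d => kinMul w y :=
    continuous_kinMul.comp (continuous_const.prodMk continuous_id)
  have hdil : ∀ s : ℝ, Continuous (kinDil s : Phase d → Phase d) := fun s =>
    (dilCLM d s).continuous
  let G : Phase d → ℝ := fun b => f (kinMul w (kinDil r b)) * φ b
  have hG : Continuous G := (hf.comp (hmul.comp (hdil r))).mul hφ
  have h1 : kconv f (kern φ r) w =
      ∫ z, (r ^ (4 * d + 2))⁻¹ * G (kinDil r⁻¹ (kinDiff w z)) := by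
    refine integral_congr_ae (ae_of_all _ fun z => ?_)
    simp only [G, kern, kinDil_inv_cancel hr.ne', kinMul_kinDiff]
    ring
  have h2 : ∫ z, G (kinDil r⁻¹ (kinDiff w z)) = ∫ y, G (kinDil r⁻¹ y) := by
    have hp := measurePreserving_kinDiff_right w
    conv_rhs => rw [← hp.map_eq]
    rw [integral_map hp.measurable.aemeasurable]
    rw [hp.map_eq]
    exact (hG.comp (hdil r⁻¹)).aestronglyMeasurable
  have h3 : ∫ y, G (kinDil r⁻¹ y) = r ^ (4 * d + 2) * ∫ b, G b := by
    rw [← integral_map (hdil r⁻¹).measurable.aemeasurable hG.aestronglyMeasurable,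
      map_kinDil_inv hr, integral_smul_measure, ENNReal.toReal_ofReal hpos.le, smul_eq_mul]
  rw [h1, integral_const_mul, h2, h3, ← mul_assoc, inv_mul_cancel₀ hpos.ne', one_mul]

/-- After the substitution `z = w ∘ δ_r b` the scale enters only through `f (w ∘ δ_r b)`, which is
continuous up to `r = 0`, where `δ_0 b` is the identity; dominated convergence applies. -/
lemma tendsto_pairing_of_continuous {f g φ : Phase d → ℝ} (hg : LocallyIntegrable g)
    (hf : Continuous f) (hfc : HasCompactSupport f) (hφ : Continuous φ)
    (hφc : HasCompactSupport φ) :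
    Tendsto (fun r => ∫ w, g w * kconv f (kern φ r) w) (𝓝[>] 0)
      (𝓝 ((∫ w, g w * f w) * ∫ b, φ b)) := by
  obtain ⟨C, hC⟩ := hfc.exists_bound_of_continuous hf
  have hφi : Integrable φ := hφ.integrable_of_hasCompactSupport hφc
  let D : Set (Phase d) :=
    (fun p : ℝ × Phase d => kinDil p.1 p.2) '' (Icc 0 1 ×ˢ tsupport φ)
  have hD : IsCompact D := (isCompact_Icc.prod hφc).image continuous_kinDil
  let K := setMul (tsupport f) (setInv D)
  have hK : IsCompact K := isCompact_setMul_setInv hfc hD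
  let F : ℝ → Phase d × Phase d → ℝ := fun r p =>
    K.indicator g p.1 * φ p.2 * f (kinMul p.1 (kinDil r p.2))
  have hcont : ∀ r, Continuous fun p : Phase d × Phase d => f (kinMul p.1 (kinDil r p.2)) :=
    fun r => hf.comp (continuous_kinMul.comp
      (continuous_fst.prodMk ((dilCLM d r).continuous.comp continuous_snd)))
  have hbase := integrable_indicator_mul_prod hg hφi hK
  have hFi : ∀ r, Integrable (F r) (volume.prod volume) := fun r =>
    hbase.mul_bdd (hcont r).aestronglyMeasurable (ae_of_all _ fun p => hC _)
  have hval : ∀ r ∈ Icc (0 : ℝ) 1, ∀ p : Phase d × Phase d,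
      F r p = g p.1 * (f (kinMul p.1 (kinDil r p.2)) * φ p.2) := by
    intro r hr p
    by_cases h1 : f (kinMul p.1 (kinDil r p.2)) * φ p.2 = 0
    · rw [h1, mul_zero]
      dsimp only [F]
      rw [mul_assoc, mul_comm (φ p.2), h1, mul_zero]
    obtain ⟨h2, h3⟩ := mul_ne_zero_iff.1 h1
    have hmem : p.1 ∈ K := mem_setMul_setInv.2 ⟨_, subset_tsupport _ h2, (r, p.2),
      ⟨hr, subset_tsupport _ h3⟩, (kinDiff_kinMul _ _).symm⟩
    dsimp only [F]
    rw [indicator_of_mem hmem]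
    ring
  have hlim : Tendsto (fun r => ∫ p, F r p ∂(volume.prod volume)) (𝓝[>] 0)
      (𝓝 (∫ p, F 0 p ∂(volume.prod volume))) := by
    refine tendsto_integral_filter_of_dominated_convergence
      (fun p => ‖K.indicator g p.1 * φ p.2‖ * C)
      (Eventually.of_forall fun r => (hFi r).aestronglyMeasurable)
      (Eventually.of_forall fun r => ae_of_all _ fun p => ?_) (hbase.norm.mul_const C)
      (ae_of_all _ fun p => ?_)
    · rw [norm_mul]
      exact mul_le_mul_of_nonneg_left (hC _) (norm_nonneg _)
    · have hc : Continuous fun r => F r p :=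
        continuous_const.mul (hf.comp (continuous_kinMul.comp
          (continuous_const.prodMk (continuous_kinDil.comp
            (continuous_id.prodMk continuous_const)))))
      exact (hc.tendsto 0).mono_left nhdsWithin_le_nhds
  have h0 : ∫ p, F 0 p ∂(volume.prod volume) = (∫ w, g w * f w) * ∫ b, φ b := by
    rw [← integral_prod_mul (fun w => g w * f w) φ]
    refine integral_congr_ae (ae_of_all _ fun p => ?_)
    have hz : kinMul p.1 (kinDil 0 p.2) = p.1 := by
      ext1
      · simp [kinMul, kinDil]
      ext1 <;> simp [kinMul, kinDil]
    simp only [hval 0 (by simp) p, hz]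
    ring
  rw [h0] at hlim
  refine hlim.congr' ?_
  filter_upwards [Ioo_mem_nhdsGT (one_pos : (0 : ℝ) < 1)] with r hr
  rw [integral_prod _ (hFi r)]
  refine integral_congr_ae (ae_of_all _ fun w => ?_)
  simp only [kconv_kern_eq hf hφ hr.1]
  rw [← integral_const_mul]
  exact integral_congr_ae (ae_of_all _ fun b => hval r (Ioo_subset_Icc_self hr) (w, b))

/-- Density of continuous functions of compact support in `L²`: by Young's inequality the error of
the approximation is uniform in `r`. -/
lemma tendsto_pairing {f g φ : Phase d → ℝ} (hg : MemLp g 2) (hf : MemLp f 2)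
    (hfc : HasCompactSupport f) (hφ : ContDiff ℝ ∞ φ)
    (hφc : HasCompactSupport φ) (hφ1 : ∫ b, φ b = 1) :
    Tendsto (fun r => ∫ w, g w * kconv f (kern φ r) w) (𝓝[>] 0) (𝓝 (∫ w, g w * f w)) := by
  have hgl : LocallyIntegrable g := hg.locallyIntegrable (by norm_num)
  have hfi : Integrable f := (integrableOn_iff_integrable_of_support_subset
    (subset_tsupport f)).1 ((hf.locallyIntegrable (by norm_num)).integrableOn_isCompact hfc)
  have hφi : Integrable φ := hφ.continuous.integrable_of_hasCompactSupport hφc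
  have hA : eLpNorm φ 1 volume ≠ ⊤ := (memLp_one_iff_integrable.2 hφi).eLpNorm_ne_top
  set A := (eLpNorm φ 1 volume).toReal with hAdef
  set N := (eLpNorm g 2 volume).toReal with hNdef
  have hA0 : 0 ≤ A := ENNReal.toReal_nonneg
  have hN0 : 0 ≤ N := ENNReal.toReal_nonneg
  rw [Metric.tendsto_nhds]
  intro ε hε
  -- The two replacements of `f` by `f'` cost `N * A * δ` and `N * δ`, together less than `ε / 2`.
  set δ := ε / (3 * (A + 1) * (N + 1)) with hδdef
  have hδ : 0 < δ := by positivity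
  obtain ⟨f', hfc', hff', hcf', hf'⟩ := hf.exists_hasCompactSupport_eLpNorm_sub_le
    (by norm_num) (ε := ENNReal.ofReal δ) (by simpa using hδ)
  have hfi' : Integrable f' := hcf'.integrable_of_hasCompactSupport hfc'
  have hlim := tendsto_pairing_of_continuous hgl hcf' hfc' hφ.continuous hφc
  rw [hφ1, mul_one, Metric.tendsto_nhds] at hlim
  have hsub : MemLp (f - f') 2 := hf.sub hf'
  have hNδ : N * δ * (A + 1) < ε / 2 := by
    rw [hδdef]
    have : N * (ε / (3 * (A + 1) * (N + 1))) * (A + 1) = ε / 3 * (N / (N + 1)) := by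
      field_simp
    rw [this]
    have : N / (N + 1) ≤ 1 := by rw [div_le_one (by positivity)]; linarith
    nlinarith
  filter_upwards [hlim (ε / 2) (by positivity), self_mem_nhdsWithin] with r hr hr0
  have hr0' : (0 : ℝ) < r := hr0
  have hkc := hasCompactSupport_kern hφc hr0'.ne'
  have hk := contDiff_kern hφ r
  have e1 : ∫ w, g w * kconv (f - f') (kern φ r) w =
      (∫ w, g w * kconv f (kern φ r) w) - ∫ w, g w * kconv f' (kern φ r) w := by
    rw [← integral_sub (integrable_mul_kconv hgl hfi hfc hkc hk.continuous)
      (integrable_mul_kconv hgl hfi' hfc' hkc hk.continuous)]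
    congr 1 with w
    rw [kconv_sub_left hfi hfi' hkc hk.continuous]
    ring
  have e2 : ∫ w, g w * (f - f') w = (∫ w, g w * f w) - ∫ w, g w * f' w := by
    have h := integral_sub (hg.integrable_mul hf) (hg.integrable_mul hf')
    simp only [Pi.mul_apply] at h
    rw [← h]
    congr 1 with w
    simp only [Pi.sub_apply]
    ring
  have b2 : ‖∫ w, g w * (f - f') w‖ ≤ N * δ := by
    have h := (enorm_integral_mul_le hg.1 hsub.1).trans (mul_le_mul_right hff' _)
    rw [← ENNReal.ofReal_toReal hg.eLpNorm_ne_top, ← ENNReal.ofReal_mul hN0,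
      ← ofReal_norm, ENNReal.ofReal_le_ofReal_iff (by positivity)] at h
    exact h
  have b1 : ‖∫ w, g w * kconv (f - f') (kern φ r) w‖ ≤ N * (A * δ) := by
    have hcm : AEStronglyMeasurable (kconv (f - f') (kern φ r)) volume :=
      (contDiff_kconv (hfi.sub hfi').locallyIntegrable hkc hk).continuous.aestronglyMeasurable
    have hy := (eLpNorm_kconv_le hsub.1 hk.continuous).trans (mul_le_mul_right hff' _)
    have h := (enorm_integral_mul_le hg.1 hcm).trans (mul_le_mul_right hy _)
    rw [eLpNorm_kern_one hφ.continuous hr0', ← ENNReal.ofReal_toReal hg.eLpNorm_ne_top,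
      ← ENNReal.ofReal_toReal hA, ← ENNReal.ofReal_mul hA0, ← ENNReal.ofReal_mul hN0,
      ← ofReal_norm, ENNReal.ofReal_le_ofReal_iff (by positivity)] at h
    exact h
  rw [e1] at b1
  rw [e2] at b2
  rw [dist_eq_norm] at hr ⊢
  rw [Real.norm_eq_abs] at *
  rw [abs_le] at b1 b2
  rw [abs_lt] at hr ⊢
  constructor <;> nlinarith [b1.1, b1.2, b2.1, b2.2, hr.1, hr.2]

end KineticNash

/-! ### Duality with the kinetic seminorm and the bound on the derivative. -/

namespace KineticNash

open Filter Topology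

variable {d : ℕ}

lemma IsTest.memLp {Ω : Set (Phase d)} {h : Phase d → ℝ} (hh : IsTest Ω h) : MemLp h 2 :=
  hh.smooth.continuous.memLp_of_hasCompactSupport hh.compact

lemma enorm_integral_mul_gradV_le {Ω : Set (Phase d)} {g h : Phase d → ℝ}
    (hg : gradVNorm Ω g ≠ ⊤) (hh : IsTest Ω h) (i : Fin d) :
    ‖∫ z in interior Ω, g z * gradV h z i‖ₑ ≤ gradVNorm Ω g * eLpNorm h 2 volume := by
  have key : ∀ G, IsWeakGradV Ω g G → ‖∫ z in interior Ω, g z * gradV h z i‖ₑ ≤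
      eLpNorm G 2 (volume.restrict (interior Ω)) * eLpNorm h 2 volume := by
    intro G hG
    rw [hG.integral_eq h hh i, enorm_neg]
    have hGi : AEStronglyMeasurable (fun z => G z i) (volume.restrict (interior Ω)) :=
      (EuclideanSpace.proj (𝕜 := ℝ) i).continuous.comp_aestronglyMeasurable hG.memLp.1
    refine (enorm_integral_mul_le hGi hh.smooth.continuous.aestronglyMeasurable).trans
      (mul_le_mul' (eLpNorm_mono fun z => ?_) (eLpNorm_mono_measure _ Measure.restrict_le_self))
    exact PiLp.norm_apply_le (G z) i
  -- Multiplication by `0` need not commute with an infimum in `ℝ≥0∞`, so here an actual weak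
  -- gradient is needed; it exists because `gradVNorm` is finite.
  by_cases h0 : eLpNorm h 2 volume = 0
  · obtain ⟨G, hG⟩ : ∃ G, IsWeakGradV Ω g G := by
      by_contra hne
      push Not at hne
      exact hg (by simp [gradVNorm, hne])
    have := key G hG
    rw [h0, mul_zero] at this ⊢
    exact this
  rw [gradVNorm, ENNReal.iInf_mul_of_ne h0 hh.memLp.eLpNorm_ne_top]
  refine le_iInf fun G => ?_
  rw [ENNReal.iInf_mul_of_ne h0 hh.memLp.eLpNorm_ne_top]
  exact le_iInf fun hG => key G hG

lemma continuous_gradV {h : Phase d → ℝ} (hh : ContDiff ℝ ∞ h) : Continuous (gradV h) := by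
  refine (PiLp.continuous_toLp 2 _).comp (continuous_pi fun i => ?_)
  exact (contDiff_fderiv_apply hh contDiff_const).continuous

lemma hasCompactSupport_gradV {h : Phase d → ℝ} (hh : HasCompactSupport h) :
    HasCompactSupport (gradV h) := by
  refine hh.of_isClosed_subset (isClosed_tsupport _)
    (closure_minimal (fun z hz => ?_) (isClosed_tsupport _))
  by_contra hn
  refine hz ?_
  have : fderiv ℝ h z = 0 := by
    by_contra h0
    exact hn (support_fderiv_subset ℝ h0)
  ext i
  simp [gradV, this]

lemma gradV_const_mul {h : Phase d → ℝ} (hh : ContDiff ℝ ∞ h) (a : ℝ) :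
    gradV (fun z => a * h z) = fun z => a • gradV h z := by
  ext z i
  simp [gradV, fderiv_const_mul (hh.differentiable (by simp) z)]

lemma transport_const_mul {h : Phase d → ℝ} (hh : ContDiff ℝ ∞ h) (a : ℝ) (z : Phase d) :
    transport (fun z => a * h z) z = a * transport h z := by
  simp [transport, fderiv_const_mul (hh.differentiable (by simp) z)]

lemma IsTest.const_mul {Ω : Set (Phase d)} {h : Phase d → ℝ} (hh : IsTest Ω h) (a : ℝ) :
    IsTest Ω fun z => a * h z :=
  ⟨contDiff_const.mul hh.smooth, hh.compact.mul_left,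
    (closure_mono fun _ hz => right_ne_zero_of_mul hz).trans hh.supp⟩

lemma eq_zero_of_gradV_eq_zero (hd : 1 ≤ d) {h : Phase d → ℝ} (hh : ContDiff ℝ ∞ h)
    (hc : HasCompactSupport h) (h0 : ∀ z, gradV h z = 0) (z : Phase d) : h z = 0 := by
  obtain ⟨R, hR⟩ := hc.isBounded.subset_closedBall 0
  let i : Fin d := ⟨0, hd⟩
  let u : Phase d := (0, 0, EuclideanSpace.single i 1)
  have hu : ‖u‖ = 1 := by simp [u, Prod.norm_def]
  have hder : ∀ ε : ℝ, HasDerivAt (fun ε : ℝ => h (z - ε • u)) 0 ε := by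
    intro ε
    have h1 := hasDerivAt_comp_sub_smul hh z u ε
    have h2 : fderiv ℝ h (z - ε • u) u = 0 := by
      have := congrArg (fun x : Vec d => x i) (h0 (z - ε • u))
      simpa [gradV] using this
    rwa [h2, neg_zero] at h1
  have hconst := is_const_of_deriv_eq_zero (fun ε => (hder ε).differentiableAt)
    (fun ε => (hder ε).deriv) 0 (|R| + ‖z‖ + 1)
  simp only [zero_smul, sub_zero] at hconst
  rw [hconst]
  refine image_eq_zero_of_notMem_tsupport fun hmem => ?_
  have h1 := mem_closedBall_zero_iff.1 (hR hmem)
  have h2 := norm_sub_norm_le ((|R| + ‖z‖ + 1) • u) z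
  rw [norm_smul, hu, Real.norm_of_nonneg (by positivity), norm_sub_rev] at h2
  have := le_abs_self R
  linarith

/-- Homogeneity removes the normalisation `‖∇_v h‖ = 1`. In the degenerate case `∇_v h = 0`, compact
support and `d ≥ 1` force `h = 0`. -/
lemma enorm_integral_mul_transport_le (hd : 1 ≤ d) {Ω : Set (Phase d)} {g h : Phase d → ℝ}
    (hh : IsTest Ω h) :
    ‖∫ z in interior Ω, g z * transport h z‖ₑ ≤
      transportDualNorm Ω g * eLpNorm (gradV h) 2 volume := by
  have hcont := continuous_gradV hh.smooth
  set μ := (volume : Measure (Phase d)).restrict (interior Ω) with hμ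
  have hle : eLpNorm (gradV h) 2 μ ≤ eLpNorm (gradV h) 2 volume :=
    eLpNorm_mono_measure _ Measure.restrict_le_self
  have htop : eLpNorm (gradV h) 2 μ ≠ ⊤ := (hle.trans_lt
    (hcont.memLp_of_hasCompactSupport (hasCompactSupport_gradV hh.compact)).eLpNorm_lt_top).ne
  refine le_trans ?_ (mul_le_mul_right hle _)
  by_cases hc : eLpNorm (gradV h) 2 μ = 0
  · have hae := (eLpNorm_eq_zero_iff hcont.aestronglyMeasurable (by norm_num)).1 hc
    have hon : EqOn (gradV h) 0 (interior Ω) :=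
      Measure.eqOn_open_of_ae_eq hae isOpen_interior hcont.continuousOn continuousOn_const
    have hall : ∀ z, gradV h z = 0 := by
      intro z
      by_cases hz : z ∈ interior Ω
      · exact hon hz
      · have : fderiv ℝ h z = 0 := by
          by_contra h0
          exact hz (hh.supp (support_fderiv_subset ℝ h0))
        ext i
        simp [gradV, this]
    have hzero : h = 0 := funext (eq_zero_of_gradV_eq_zero hd hh.smooth hh.compact hall)
    have : ∀ z, transport h z = 0 := fun z => by
      rw [hzero]
      simp [transport]
    simp [this]
  set c := (eLpNorm (gradV h) 2 μ).toReal with hcdef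
  have hcpos : 0 < c := ENNReal.toReal_pos hc htop
  have hcE : ENNReal.ofReal c = eLpNorm (gradV h) 2 μ := ENNReal.ofReal_toReal htop
  -- Both signs of `a` are needed, since `ENNReal.ofReal` truncates negative pairings.
  have key : ∀ a : ℝ, |a| = c⁻¹ →
      ENNReal.ofReal (-(a * ∫ z, g z * transport h z ∂μ)) ≤ transportDualNorm Ω g := by
    intro a ha
    have hn : eLpNorm (gradV fun z => a * h z) 2 μ = 1 := by
      rw [gradV_const_mul hh.smooth]
      change eLpNorm (a • gradV h) 2 μ = 1
      rw [eLpNorm_const_smul, ← ofReal_norm, Real.norm_eq_abs, ha, ← hcE,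
        ← ENNReal.ofReal_mul (by positivity), inv_mul_cancel₀ hcpos.ne', ENNReal.ofReal_one]
    have hp : transportPairing Ω g (fun z => a * h z) = -(a * ∫ z, g z * transport h z ∂μ) := by
      rw [transportPairing, ← integral_const_mul]
      congr 2 with z
      rw [transport_const_mul hh.smooth]
      ring
    rw [← hp]
    exact le_iSup_of_le _ (le_iSup_of_le (hh.const_mul a) (le_iSup_of_le hn le_rfl))
  have habs : ENNReal.ofReal (c⁻¹ * |∫ z, g z * transport h z ∂μ|) ≤ transportDualNorm Ω g := by
    rcases abs_cases (∫ z, g z * transport h z ∂μ) with ⟨h1, -⟩ | ⟨h1, -⟩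
    · have := key (-c⁻¹) (by rw [abs_neg, abs_of_pos (by positivity)])
      rw [h1]
      convert this using 2
      ring
    · have := key c⁻¹ (abs_of_pos (by positivity))
      rw [h1]
      convert this using 2
      ring
  calc ‖∫ z, g z * transport h z ∂μ‖ₑ
      = ENNReal.ofReal (c⁻¹ * |∫ z, g z * transport h z ∂μ|) * ENNReal.ofReal c := by
        rw [← ENNReal.ofReal_mul (by positivity), ← ofReal_norm, Real.norm_eq_abs]
        congr 1
        field_simp
    _ ≤ transportDualNorm Ω g * eLpNorm (gradV h) 2 μ := by
        rw [hcE]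
        gcongr

lemma eLpNorm_gradV_le {h : Phase d → ℝ} (hh : ContDiff ℝ ∞ h) :
    eLpNorm (gradV h) 2 volume ≤ ∑ i, eLpNorm (fun z => gradV h z i) 2 volume := by
  have hc : ∀ i, Continuous fun z => gradV h z i := fun i =>
    (EuclideanSpace.proj (𝕜 := ℝ) i).continuous.comp (continuous_gradV hh)
  have h1 : gradV h = ∑ i, fun z => gradV h z i • EuclideanSpace.single i (1 : ℝ) := by
    ext1 z
    rw [Finset.sum_apply, sum_smul_single]
  conv_lhs => rw [h1]
  refine (eLpNorm_sum_le (fun i _ => ((hc i).smul continuous_const).aestronglyMeasurable)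
    (by norm_num)).trans_eq ?_
  refine Finset.sum_congr rfl fun i _ => eLpNorm_congr_norm_ae (ae_of_all _ fun z => ?_)
  simp [norm_smul]

/-- The part of `Ω` outside its interior may have positive measure; the vanishing of `k` there makes
it harmless. -/
lemma integral_indicator_mul_eq {Ω : Set (Phase d)} {g k : Phase d → ℝ}
    (hk : ∀ z ∉ interior Ω, k z = 0) :
    ∫ z, Ω.indicator g z * k z = ∫ z in interior Ω, g z * k z := by
  rw [← integral_indicator isOpen_interior.measurableSet]
  congr 1 with z
  by_cases hz : z ∈ interior Ω
  · rw [indicator_of_mem hz, indicator_of_mem (interior_subset hz)]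
  · rw [indicator_of_notMem hz, hk z hz, mul_zero]

lemma kern_dilGen_eq {φ : Phase d → ℝ} (hφ : ContDiff ℝ ∞ φ) {r : ℝ} (hr : r ≠ 0) (y : Phase d) :
    kern (dilGen φ) r y = r ^ 2 * derivT (kern (compT φ) r) y +
      ∑ i, r * derivV i (kern (compV φ i) r) y := by
  simp only [derivT_kern (contDiff_compT hφ), derivV_kern (contDiff_compV hφ _)]
  simp only [kern, dilGen_eq hφ, mul_add, Finset.mul_sum]
  congr 1
  · field_simp
  · refine Finset.sum_congr rfl fun i _ => ?_
    field_simp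

/-- The constant that controls the derivative of `r ↦ ∫ g · kconv f (kern φ r)`. -/
noncomputable def decompNorm (φ : Phase d → ℝ) : ℝ≥0∞ :=
  ∑ i, eLpNorm (derivV i (compT φ)) 1 volume + ∑ i, eLpNorm (compV φ i) 1 volume

lemma decompNorm_ne_top {φ : Phase d → ℝ} (hφ : ContDiff ℝ ∞ φ) (hφc : HasCompactSupport φ) :
    decompNorm φ ≠ ⊤ := by
  have h : ∀ {k : Phase d → ℝ}, Continuous k → tsupport k ⊆ tsupport φ →
      eLpNorm k 1 volume ≠ ⊤ := fun hk hs =>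
    (hk.memLp_of_hasCompactSupport
      (hφc.of_isClosed_subset (isClosed_tsupport _) hs)).eLpNorm_ne_top
  refine ENNReal.add_ne_top.2 ⟨ENNReal.sum_ne_top.2 fun i _ => ?_,
    ENNReal.sum_ne_top.2 fun i _ => ?_⟩
  · exact h (contDiff_derivV i (contDiff_compT hφ)).continuous
      ((tsupport_derivV_subset i _).trans tsupport_compT_subset)
  · exact h (contDiff_compV hφ i).continuous (tsupport_compV_subset i)

/-- The heart of the proof: the bound does not depend on `r`. The powers `r²` and `r` from
`kern_dilGen_eq`, divided by `r`, leave `r ∫ g Y h₀` and `∫ g ∂_{v_i} h_i`; the first is compensated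
by `‖∇_v h₀‖ ≲ r⁻¹ ‖f‖`. -/
lemma enorm_deriv_pairing_le (hd : 1 ≤ d) {Ω S B : Set (Phase d)} {f g φ : Phase d → ℝ}
    (hgl : LocallyIntegrable (Ω.indicator g)) (hgt : gradVNorm Ω g ≠ ⊤) (hB : IsOpen B)
    (hf : Integrable f) (hfc : HasCompactSupport f) (hfS : Function.support f ⊆ S)
    (hφ : ContDiff ℝ ∞ φ) (hφc : HasCompactSupport φ) (hφB : tsupport φ ⊆ B) {r : ℝ} (hr : 0 < r)
    (hS : setMul S (setInv (setDil r B)) ⊆ Ω) :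
    ‖-r⁻¹ * ∫ w, Ω.indicator g w * kconv f (kern (dilGen φ) r) w‖ₑ ≤
      decompNorm φ * kinSeminorm Ω g * eLpNorm f 2 volume := by
  have hcs : ∀ {k : Phase d → ℝ}, tsupport k ⊆ tsupport φ → HasCompactSupport k := fun h =>
    hφc.of_isClosed_subset (isClosed_tsupport _) h
  have htest : ∀ {k : Phase d → ℝ}, ContDiff ℝ ∞ k → tsupport k ⊆ tsupport φ →
      IsTest Ω (kconv f (kern k r)) := fun hk hs =>
    isTest_kconv hf.locallyIntegrable hfc (hasCompactSupport_kern (hcs hs) hr.ne')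
      (contDiff_kern hk r) hfS (isOpen_setDil hB hr.ne')
      ((tsupport_kern_subset (hcs hs) hr.ne').trans (image_mono (hs.trans hφB))) hS
  have hT := contDiff_kern (contDiff_compT hφ) r
  have hV := fun i => contDiff_kern (contDiff_compV hφ i) r
  have hTc : HasCompactSupport (kern (compT φ) r) :=
    hasCompactSupport_kern (hcs tsupport_compT_subset) hr.ne'
  have hVc : ∀ i, HasCompactSupport (kern (compV φ i) r) := fun i =>
    hasCompactSupport_kern (hcs (tsupport_compV_subset i)) hr.ne'
  have htT := htest (contDiff_compT hφ) tsupport_compT_subset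
  have htV := fun i => htest (contDiff_compV hφ i) (tsupport_compV_subset i)
  set h₀ := kconv f (kern (compT φ) r) with hh₀
  have hfd0 : ∀ {h : Phase d → ℝ}, IsTest Ω h → ∀ z ∉ interior Ω, fderiv ℝ h z = 0 := by
    intro h hh z hz
    by_contra h0
    exact hz (hh.supp (support_fderiv_subset ℝ h0))
  have hsplit : ∀ w, Ω.indicator g w * kconv f (kern (dilGen φ) r) w =
      r ^ 2 * (Ω.indicator g w * kconv f (derivT (kern (compT φ) r)) w) +
        ∑ i, r * (Ω.indicator g w * kconv f (derivV i (kern (compV φ i) r)) w) := by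
    intro w
    have : kern (dilGen φ) r = fun y => r ^ 2 * derivT (kern (compT φ) r) y +
      ∑ i, r * derivV i (kern (compV φ i) r) y := funext (kern_dilGen_eq hφ hr.ne')
    have c1 : HasCompactSupport fun y => r ^ 2 * derivT (kern (compT φ) r) y :=
      (hasCompactSupport_derivT hTc).mul_left
    have c2 : ∀ i, HasCompactSupport fun y => r * derivV i (kern (compV φ i) r) y := fun i =>
      (hasCompactSupport_derivV i (hVc i)).mul_left
    have d1 := (contDiff_derivT hT).continuous
    have d2 := fun i => (contDiff_derivV i (hV i)).continuous
    have c3 : HasCompactSupport fun y => ∑ i, r * derivV i (kern (compV φ i) r) y := by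
      refine (hφc.image (dilCLM d r).continuous).of_isClosed_subset (isClosed_tsupport _)
        (closure_minimal (fun y hy => ?_) (hφc.image (dilCLM d r).continuous).isClosed)
      obtain ⟨i, -, hi⟩ := Finset.exists_ne_zero_of_sum_ne_zero hy
      exact image_mono (tsupport_compV_subset i)
        (tsupport_kern_subset (hcs (tsupport_compV_subset i)) hr.ne'
          (tsupport_derivV_subset i _ (subset_tsupport _ (right_ne_zero_of_mul hi))))
    rw [this, kconv_add_right hf c1 (continuous_const.mul d1) c3
      (continuous_finsetSum _ fun i _ => continuous_const.mul (d2 i)),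
      kconv_sum_right _ hf c2 (fun i => continuous_const.mul (d2 i)),
      kconv_const_mul_right, mul_add, Finset.mul_sum]
    simp only [kconv_const_mul_right]
    congr 1
    · ring
    · exact Finset.sum_congr rfl fun i _ => by ring
  have hI0 : Integrable fun w => Ω.indicator g w * kconv f (derivT (kern (compT φ) r)) w :=
    integrable_mul_kconv hgl hf hfc (hasCompactSupport_derivT hTc) (contDiff_derivT hT).continuous
  have hIi : ∀ i, Integrable fun w =>
      Ω.indicator g w * kconv f (derivV i (kern (compV φ i) r)) w := fun i =>
    integrable_mul_kconv hgl hf hfc (hasCompactSupport_derivV i (hVc i))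
      (contDiff_derivV i (hV i)).continuous
  have e0 : ∫ w, Ω.indicator g w * kconv f (derivT (kern (compT φ) r)) w =
      -∫ z in interior Ω, g z * transport h₀ z := by
    rw [← integral_indicator_mul_eq fun z hz => by rw [transport, hfd0 htT z hz]; rfl,
      ← integral_neg]
    congr 1 with w
    rw [hh₀, transport_kconv hf hTc hT]
    ring
  have ei : ∀ i, ∫ w, Ω.indicator g w * kconv f (derivV i (kern (compV φ i) r)) w =
      -∫ z in interior Ω, g z * gradV (kconv f (kern (compV φ i) r)) z i := by
    intro i
    rw [← integral_indicator_mul_eq fun z hz => by simp [gradV, hfd0 (htV i) z hz],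
      ← integral_neg]
    congr 1 with w
    rw [gradV_kconv hf (hVc i) (hV i)]
    ring
  have hval : -r⁻¹ * ∫ w, Ω.indicator g w * kconv f (kern (dilGen φ) r) w =
      r * (∫ z in interior Ω, g z * transport h₀ z) +
        ∑ i, ∫ z in interior Ω, g z * gradV (kconv f (kern (compV φ i) r)) z i := by
    simp only [hsplit]
    rw [integral_add (hI0.const_mul _) (integrable_finsetSum _ fun i _ => (hIi i).const_mul _),
      integral_finsetSum _ fun i _ => (hIi i).const_mul _, integral_const_mul, e0]
    simp only [integral_const_mul, ei, mul_add, Finset.mul_sum]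
    congr 1
    · field_simp
    · exact Finset.sum_congr rfl fun i _ => by field_simp
  rw [hval]
  have b0 : ‖r * (∫ z in interior Ω, g z * transport h₀ z)‖ₑ ≤
      (∑ i, eLpNorm (derivV i (compT φ)) 1 volume) * kinSeminorm Ω g * eLpNorm f 2 volume := by
    have hg0 : eLpNorm (gradV h₀) 2 volume ≤ ENNReal.ofReal r⁻¹ *
        ((∑ i, eLpNorm (derivV i (compT φ)) 1 volume) * eLpNorm f 2 volume) := by
      refine (eLpNorm_gradV_le htT.smooth).trans ?_
      rw [Finset.sum_mul, Finset.mul_sum]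
      refine Finset.sum_le_sum fun i _ => ?_
      have hd' := contDiff_derivV i (contDiff_compT hφ)
      have : (fun z => gradV h₀ z i) = (-r⁻¹) • kconv f (kern (derivV i (compT φ)) r) := by
        ext z
        rw [hh₀, gradV_kconv hf hTc hT, funext (derivV_kern (contDiff_compT hφ) i r),
          kconv_const_mul_right]
        simp
      rw [this, eLpNorm_const_smul, enorm_neg, Real.enorm_eq_ofReal (by positivity)]
      gcongr
      rw [← eLpNorm_kern_one hd'.continuous hr]
      exact eLpNorm_kconv_le hf.1 (contDiff_kern hd' r).continuous
    have h1 := enorm_integral_mul_transport_le hd (g := g) htT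
    rw [enorm_mul, Real.enorm_eq_ofReal hr.le]
    calc _ ≤ ENNReal.ofReal r * (kinSeminorm Ω g * (ENNReal.ofReal r⁻¹ *
        ((∑ i, eLpNorm (derivV i (compT φ)) 1 volume) * eLpNorm f 2 volume))) := by
          gcongr
          exact h1.trans (mul_le_mul' le_add_self hg0)
      _ = (ENNReal.ofReal r * ENNReal.ofReal r⁻¹) *
          ((∑ i, eLpNorm (derivV i (compT φ)) 1 volume) * kinSeminorm Ω g *
            eLpNorm f 2 volume) := by ring
      _ = _ := by
          rw [← ENNReal.ofReal_mul hr.le, mul_inv_cancel₀ hr.ne', ENNReal.ofReal_one, one_mul]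
  have bi : ∀ i, ‖∫ z in interior Ω, g z * gradV (kconv f (kern (compV φ i) r)) z i‖ₑ ≤
      eLpNorm (compV φ i) 1 volume * kinSeminorm Ω g * eLpNorm f 2 volume := by
    intro i
    refine (enorm_integral_mul_gradV_le hgt (htV i) i).trans ?_
    have hy := eLpNorm_kconv_le (k := kern (compV φ i) r) hf.1 (hV i).continuous
    rw [eLpNorm_kern_one (contDiff_compV hφ i).continuous hr] at hy
    calc _ ≤ kinSeminorm Ω g * (eLpNorm (compV φ i) 1 volume * eLpNorm f 2 volume) :=
          mul_le_mul' le_self_add hy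
      _ = _ := by ring
  refine (enorm_add_le _ _).trans ?_
  rw [decompNorm, add_mul, add_mul]
  refine add_le_add b0 ((enorm_sum_le _ _).trans ((Finset.sum_le_sum fun i _ => bi i).trans_eq ?_))
  rw [Finset.sum_mul, Finset.sum_mul]

end KineticNash

/-! ### Integration in the scale and conclusion. -/

namespace KineticNash

open Filter Topology

variable {d : ℕ}

lemma nash_of_hasCompactSupport (hd : 1 ≤ d) {Ω S B : Set (Phase d)} {f g φ : Phase d → ℝ} {C : ℝ}
    (hg : MemLp (Ω.indicator g) 2) (hgk : kinSeminorm Ω g ≠ ⊤) (hB : IsOpen B)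
    (hf : MemLp f 2) (hfc : HasCompactSupport f) (hfS : Function.support f ⊆ S)
    (hφ : ContDiff ℝ ∞ φ) (hφc : HasCompactSupport φ) (hφB : tsupport φ ⊆ B)
    (hφ1 : ∫ b, φ b = 1) (hC : ∀ y, ‖φ y‖ ≤ C) {s : ℝ} (hs : 0 < s)
    (hS : ∀ r ∈ Ioc 0 s, setMul S (setInv (setDil r B)) ⊆ Ω) :
    ‖∫ w, Ω.indicator g w * f w‖ₑ ≤
      ENNReal.ofReal s * (decompNorm φ * kinSeminorm Ω g * eLpNorm f 2 volume) +
        ENNReal.ofReal ((s ^ (4 * d + 2))⁻¹ * C) *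
          (eLpNorm f 1 volume * eLpNorm (Ω.indicator g) 1 volume) := by
  have hgl : LocallyIntegrable (Ω.indicator g) := hg.locallyIntegrable (by norm_num)
  have hfi : Integrable f := (integrableOn_iff_integrable_of_support_subset
    (subset_tsupport f)).1 ((hf.locallyIntegrable (by norm_num)).integrableOn_isCompact hfc)
  have hgt : gradVNorm Ω g ≠ ⊤ := ne_top_of_le_ne_top hgk le_self_add
  set M := decompNorm φ * kinSeminorm Ω g * eLpNorm f 2 volume with hM
  have hMt : M ≠ ⊤ :=
    ENNReal.mul_ne_top (ENNReal.mul_ne_top (decompNorm_ne_top hφ hφc) hgk) hf.eLpNorm_ne_top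
  let F : ℝ → ℝ := fun r => ∫ w, Ω.indicator g w * kconv f (kern φ r) w
  have hder : ∀ r ∈ Ioc 0 s, HasDerivWithinAt F
      (-r⁻¹ * ∫ w, Ω.indicator g w * kconv f (kern (dilGen φ) r) w) (Ioc 0 s) r := fun r hr =>
    (hasDerivAt_pairing hgl hfi hfc hφc hφ hr.1).hasDerivWithinAt
  have hbd : ∀ r ∈ Ioc 0 s,
      ‖-r⁻¹ * ∫ w, Ω.indicator g w * kconv f (kern (dilGen φ) r) w‖ ≤ M.toReal := by
    intro r hr
    have h := enorm_deriv_pairing_le hd hgl hgt hB hfi hfc hfS hφ hφc hφB hr.1 (hS r hr)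
    rw [← toReal_enorm]
    exact ENNReal.toReal_mono hMt h
  have hF : ∀ r ∈ Ioc 0 s, ‖F r‖ ≤ ‖F s‖ + M.toReal * s := by
    intro r hr
    -- The mean value inequality is used on `(0, s]` only; the endpoint `0` is reached by the limit
    -- `hlim`.
    have h := Convex.norm_image_sub_le_of_norm_hasDerivWithin_le hder hbd (convex_Ioc 0 s)
      ⟨hs, le_rfl⟩ hr
    have h1 : ‖r - s‖ ≤ s := by
      rw [Real.norm_eq_abs, abs_le]
      constructor <;> linarith [hr.1, hr.2]
    have h2 := norm_sub_norm_le (F r) (F s)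
    have h3 : M.toReal * ‖r - s‖ ≤ M.toReal * s :=
      mul_le_mul_of_nonneg_left h1 ENNReal.toReal_nonneg
    linarith
  have hlim : Tendsto F (𝓝[>] 0) (𝓝 (∫ w, Ω.indicator g w * f w)) :=
    tendsto_pairing hg hf hfc hφ hφc hφ1
  have hle : ‖∫ w, Ω.indicator g w * f w‖ ≤ ‖F s‖ + M.toReal * s := by
    refine le_of_tendsto hlim.norm ?_
    filter_upwards [Ioc_mem_nhdsGT hs] with r hr using hF r hr
  have hFs : ‖F s‖ₑ ≤ ENNReal.ofReal ((s ^ (4 * d + 2))⁻¹ * C) *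
      (eLpNorm f 1 volume * eLpNorm (Ω.indicator g) 1 volume) := by
    refine enorm_integral_mul_kconv_le (fun y => ?_) hf.1 hg.1
    rw [kern, norm_mul, Real.norm_of_nonneg (by positivity)]
    gcongr
    exact hC _
  calc ‖∫ w, Ω.indicator g w * f w‖ₑ
      ≤ ENNReal.ofReal (‖F s‖ + M.toReal * s) := by
        rw [← ofReal_norm]
        exact ENNReal.ofReal_le_ofReal hle
    _ = ‖F s‖ₑ + ENNReal.ofReal s * M := by
        rw [ENNReal.ofReal_add (norm_nonneg _) (by positivity), ofReal_norm,
          ENNReal.ofReal_mul ENNReal.toReal_nonneg, ENNReal.ofReal_toReal hMt, mul_comm M]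
    _ ≤ _ := by
        rw [add_comm]
        gcongr

lemma nash_of_isBounded (hd : 1 ≤ d) {Ω S B : Set (Phase d)} {g φ : Phase d → ℝ} {C : ℝ}
    (hΩ : MeasurableSet Ω) (hSm : MeasurableSet S) (hSb : Bornology.IsBounded S) (hSΩ : S ⊆ Ω)
    (hg : MemKinH1 Ω g) (hB : IsOpen B)
    (hφ : ContDiff ℝ ∞ φ) (hφc : HasCompactSupport φ) (hφB : tsupport φ ⊆ B)
    (hφ1 : ∫ b, φ b = 1) (hC : ∀ y, ‖φ y‖ ≤ C) {s : ℝ} (hs : 0 < s)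
    (hS : ∀ r ∈ Ioc 0 s, setMul S (setInv (setDil r B)) ⊆ Ω) :
    eLpNorm g 2 (volume.restrict S) ^ 2 ≤
      ENNReal.ofReal s *
          (decompNorm φ * kinSeminorm Ω g * eLpNorm g 2 (volume.restrict Ω)) +
        ENNReal.ofReal ((s ^ (4 * d + 2))⁻¹ * C) * eLpNorm g 1 (volume.restrict Ω) ^ 2 := by
  have hgΩ : MemLp (Ω.indicator g) 2 := (memLp_indicator_iff_restrict hΩ).2 hg.memLp
  have hf : MemLp (S.indicator g) 2 := by
    rw [← inter_eq_left.2 hSΩ, ← indicator_indicator]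
    exact hgΩ.indicator hSm
  have hfc : HasCompactSupport (S.indicator g) :=
    hSb.isCompact_closure.of_isClosed_subset (isClosed_tsupport _)
      (closure_mono (support_indicator_subset))
  have hmain := nash_of_hasCompactSupport hd hgΩ hg.seminorm_lt_top.ne hB hf hfc
    support_indicator_subset hφ hφc hφB hφ1 hC hs hS
  have hlhs : ‖∫ w, Ω.indicator g w * S.indicator g w‖ₑ = eLpNorm g 2 (volume.restrict S) ^ 2 := by
    have h1 : ∀ w, Ω.indicator g w * S.indicator g w = S.indicator g w ^ 2 := by
      intro w
      by_cases hw : w ∈ S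
      · rw [indicator_of_mem hw, indicator_of_mem (hSΩ hw)]
        ring
      · rw [indicator_of_notMem hw]
        ring
    simp only [h1]
    rw [← eLpNorm_indicator_eq_eLpNorm_restrict hSm, eLpNorm_two_sq,
      Real.enorm_eq_ofReal (integral_nonneg fun w => sq_nonneg _),
      ofReal_integral_eq_lintegral_ofReal hf.integrable_sq (ae_of_all _ fun w => sq_nonneg _)]
    refine lintegral_congr fun w => ?_
    rw [← Real.enorm_eq_ofReal (sq_nonneg _), enorm_pow]
  have hp : ∀ p, eLpNorm (S.indicator g) p volume ≤ eLpNorm g p (volume.restrict Ω) := by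
    intro p
    rw [eLpNorm_indicator_eq_eLpNorm_restrict hSm]
    exact eLpNorm_mono_measure _ (Measure.restrict_mono hSΩ le_rfl)
  rw [hlhs, eLpNorm_indicator_eq_eLpNorm_restrict hΩ] at hmain
  refine hmain.trans ?_
  rw [sq (eLpNorm g 1 _)]
  gcongr
  · exact hp 2
  · exact hp 1

/-- `δ_0` collapses the nonempty set `B` to the group identity. -/
lemma subset_of_setMul_dil_zero {Ω₁ Ω₂ B : Set (Phase d)} (hB : B.Nonempty)
    (h : setMul Ω₁ (setInv (setDil 0 B)) ⊆ Ω₂) : Ω₁ ⊆ Ω₂ := by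
  obtain ⟨b, hb⟩ := hB
  refine fun z hz => h (mem_setMul_setInv.2 ⟨z, hz, b, hb, ?_⟩)
  rw [kinDiff_eq]
  simp [kinDil]

lemma exists_normalized_bump {B : Set (Phase d)} (hB : IsOpen B) (hne : B.Nonempty) :
    ∃ φ : Phase d → ℝ, ContDiff ℝ ∞ φ ∧ HasCompactSupport φ ∧ tsupport φ ⊆ B ∧
      ∫ b, φ b = 1 := by
  obtain ⟨b, hb⟩ := hne
  obtain ⟨ε, hε, hεB⟩ := Metric.isOpen_iff.1 hB b hb
  let ψ : ContDiffBump b := ⟨ε / 4, ε / 2, by linarith, by linarith⟩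
  refine ⟨ψ.normed volume, ψ.contDiff_normed, ψ.hasCompactSupport_normed, ?_, ψ.integral_normed⟩
  rw [ψ.tsupport_normed_eq]
  exact (Metric.closedBall_subset_ball (half_lt_self hε)).trans hεB

end KineticNash

open KineticNash
theorem theorem1p2 (d : ℕ) (hd : 1 ≤ d) (B : Set (Phase d)) (hB_open : IsOpen B)
    (hB_bdd : Bornology.IsBounded B) (hB_ne : B.Nonempty) :
    ∃ C : ℝ≥0, ∀ s₀ : ℝ, 0 < s₀ → ∀ Ω₁ Ω₂ : Set (Phase d),
      MeasurableSet Ω₁ → MeasurableSet Ω₂ →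
      (∀ z ∈ Ω₁, 0 ≤ z.1) → (∀ z ∈ Ω₂, 0 ≤ z.1) →
      (∀ s ∈ Set.Icc (0 : ℝ) s₀, setMul Ω₁ (setInv (setDil s B)) ⊆ Ω₂) →
      ∀ g : Phase d → ℝ, MemKinH1 Ω₂ g → ∀ s ∈ Set.Ioc (0 : ℝ) s₀,
        eLpNorm g 2 (volume.restrict Ω₁) ^ 2 ≤
          (C : ℝ≥0∞) *
            (ENNReal.ofReal s * kinSeminorm Ω₂ g * eLpNorm g 2 (volume.restrict Ω₂) +
              ENNReal.ofReal (1 / s ^ (4 * d + 2)) *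
                eLpNorm g 1 (volume.restrict Ω₂) ^ 2) := by
  obtain ⟨φ, hφ, hφc, hφB, hφ1⟩ := exists_normalized_bump hB_open hB_ne
  obtain ⟨M, hM⟩ := hφc.exists_bound_of_continuous hφ.continuous
  have hD := decompNorm_ne_top hφ hφc
  -- `decompNorm φ` serves the seminorm term and the sup bound `M` of `φ` the `L¹` term; both are
  -- fixed once `φ` is chosen from `B`.
  refine ⟨(decompNorm φ).toNNReal + M.toNNReal, fun s₀ hs₀ Ω₁ Ω₂ hm₁ hm₂ _ _ hΩ g hg s hs => ?_⟩
  have hsub := subset_of_setMul_dil_zero hB_ne (hΩ 0 ⟨le_rfl, hs₀.le⟩)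
  rw [ENNReal.coe_add, ENNReal.coe_toNNReal hD,
    show ((M.toNNReal : ℝ≥0) : ℝ≥0∞) = ENNReal.ofReal M from rfl]
  -- Truncation to balls makes the test functions compactly supported. The bound is independent of
  -- `n`, so monotone convergence recovers `Ω₁`.
  have hbound : ∀ n : ℕ, eLpNorm g 2 (volume.restrict (Ω₁ ∩ Metric.closedBall 0 n)) ^ 2 ≤
      (decompNorm φ + ENNReal.ofReal M) *
            (ENNReal.ofReal s * kinSeminorm Ω₂ g * eLpNorm g 2 (volume.restrict Ω₂) +
              ENNReal.ofReal (1 / s ^ (4 * d + 2)) *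
                eLpNorm g 1 (volume.restrict Ω₂) ^ 2) := by
    intro n
    refine (nash_of_isBounded hd hm₂ (hm₁.inter Metric.isClosed_closedBall.measurableSet)
      (Metric.isBounded_closedBall.subset inter_subset_right) (inter_subset_left.trans hsub)
      hg hB_open hφ hφc hφB hφ1 hM hs.1 fun r hr =>
        (image2_subset_right inter_subset_left).trans (hΩ r ⟨hr.1.le, hr.2.trans hs.2⟩)).trans ?_
    have hs1 := hs.1
    rw [one_div, ENNReal.ofReal_mul (by positivity)]
    calc _ = decompNorm φ *
          (ENNReal.ofReal s * kinSeminorm Ω₂ g * eLpNorm g 2 (volume.restrict Ω₂)) +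
        ENNReal.ofReal M * (ENNReal.ofReal (s ^ (4 * d + 2))⁻¹ *
          eLpNorm g 1 (volume.restrict Ω₂) ^ 2) := by ring
      _ ≤ _ := by
        rw [mul_add]
        gcongr
        · exact le_self_add
        · exact le_add_self
  have hU : Ω₁ = ⋃ n : ℕ, Ω₁ ∩ Metric.closedBall (0 : Phase d) n := by
    rw [← inter_iUnion, Metric.iUnion_closedBall_nat, inter_univ]
  have hdir : Directed (· ⊆ ·) fun n : ℕ => Ω₁ ∩ Metric.closedBall (0 : Phase d) n :=
    Monotone.directed_le fun m n hmn =>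
      inter_subset_inter_right _ (Metric.closedBall_subset_closedBall (by exact_mod_cast hmn))
  simp only [eLpNorm_two_sq (μ := volume.restrict Ω₁)]
  rw [hU, setLIntegral_iUnion_of_directed _ hdir]
  refine iSup_le fun n => ?_
  rw [← eLpNorm_two_sq]
  exact hbound n
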